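/- Let $K$ be a field, let $m\geq 1$ be an integer and let $\mathbf q=(q_0,\dots,q_{m-1})\in (K^*)^m$. Let $\mathcal Q$ be the quiver with $m$ vertices $0,1,\dots,m-1$ and $2m$ arrows, namely an arrow $a_i$ from $i$ to $i+1$ and an arrow $\bar a_i$ from $i+1$ to $i$ for each $i$, where all indices are taken modulo $m$. Paths are written from left to right. Let $\Lambda_{\mathbf q}=K\mathcal Q/I_{\mathbf q}$, where $I_{\mathbf q}$ is the ideal of the path algebra $K\mathcal Q$ generated by $$a_ia_{i+1},\qquad \bar a_{i-1}\bar a_{i-2},\qquad q_ia_i\bar a_i-\bar a_{i-1}a_{i-1}\qquad (i=0,\dots,m-1),$$ and let $\zeta=q_0q_1\cdots q_{m-1}\in K^*$. Let $\mathfrak r$ be the Jacobson radical of $\Lambda_{\mathbf q}$, let $$E(\Lambda_{\mathbf q})=\bigoplus_{n\geq 0}\operatorname{Ext}^n_{\Lambda_{\mathbf q}}(\Lambda_{\mathbf q}/\mathfrak r,\Lambda_{\mathbf q}/\mathfrak r)$$ be the Ext algebra of $\Lambda_{\mathbf q}$, with the Yoneda product, and let $Z_{\mathrm{gr}}(E(\Lambda_{\mathbf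 q}))$ be its graded centre, that is, the subring generated by all homogeneous elements $z$, of degree $n$ say, such that $zg=(-1)^{kn}gz$ for every $k\geq 0$ and every homogeneous element $g$ of degree $k$ of $E(\Lambda_{\mathbf q})$. Then $E(\Lambda_{\mathbf q})$ is a finitely generated module over $Z_{\mathrm{gr}}(E(\Lambda_{\mathbf q}))$ if and only if $\zeta$ is a root of unity, that is, $\zeta^d=1$ for some integer $d\geq 1$. -/

import Mathlib

open CategoryTheory
open scoped DirectSum

universe u

noncomputable section

section PathAlgebra

/-- A path in the quiver `V` together with its two endpoints; the trivial path at a vertex `v` is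
`Quiver.Path.nil : Quiver.Path v v`. -/
structure QuiverPath (V : Type) [Quiver.{0} V] : Type where
  src : V
  tgt : V
  path : Quiver.Path src tgt

/-- The path algebra `K V` of a quiver `V`: the `K`-vector space with basis the paths of `V`. -/
def PathAlgebra (K : Type u) [Field K] (V : Type) [Quiver.{0} V] : Type u :=
  QuiverPath V →₀ K

namespace PathAlgebra

variable (K : Type u) [Field K] {V : Type} [Quiver.{0} V]

instance : AddCommGroup (PathAlgebra K V) := inferInstanceAs (AddCommGroup (QuiverPath V →₀ K))

instance : Module K (PathAlgebra K V) := inferInstanceAs (Module K (QuiverPath V →₀ K))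

/-- A path, as a basis element of the path algebra. -/
def ofPath (p : QuiverPath V) : PathAlgebra K V := Finsupp.single p 1

open Classical in
/-- The product of two paths, written from left to right: the path `p` followed by the path `r`
if `p` ends where `r` starts, and zero otherwise. -/
def pathMul (p r : QuiverPath V) : PathAlgebra K V :=
  if h : r.src = p.tgt then ofPath K ⟨p.src, r.tgt, p.path.comp (r.path.cast h rfl)⟩ else 0

/-- The bilinear extension of `pathMul`. -/
def mulMap : PathAlgebra K V →ₗ[K] PathAlgebra K V →ₗ[K] PathAlgebra K V :=
  Finsupp.linearCombination K fun p : QuiverPath V =>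
    (Finsupp.linearCombination K fun r : QuiverPath V => pathMul K p r :
      (QuiverPath V →₀ K) →ₗ[K] PathAlgebra K V)

instance : Mul (PathAlgebra K V) := ⟨fun x y => mulMap K x y⟩

/-- The identity is the sum of the trivial paths. -/
instance [Fintype V] : One (PathAlgebra K V) :=
  ⟨∑ v : V, ofPath K ⟨v, v, Quiver.Path.nil⟩⟩

theorem ofPath_mul_ofPath (p r : QuiverPath V) :
    ofPath K p * ofPath K r = pathMul K p r := by
  change mulMap K (ofPath K p) (ofPath K r) = _
  have h : mulMap K (ofPath K p) = (Finsupp.linearCombination K fun r : QuiverPath V =>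
      pathMul K p r : (QuiverPath V →₀ K) →ₗ[K] PathAlgebra K V) :=
    (Finsupp.linearCombination_single K (1 : K) p).trans (one_smul K _)
  rw [h]
  exact (Finsupp.linearCombination_single K (1 : K) r).trans (one_smul K _)

theorem induction_on {P : PathAlgebra K V → Prop} (x : PathAlgebra K V) (h0 : P 0)
    (hadd : ∀ x y, P x → P y → P (x + y)) (hof : ∀ (c : K) (p), P (c • ofPath K p)) : P x := by
  refine Finsupp.induction_linear (motive := P) x h0 hadd ?_
  intro p c
  have : (Finsupp.single p c : QuiverPath V →₀ K) = c • Finsupp.single p (1 : K) := by simp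
  rw [this]
  exact hof c p

theorem add_mul' (x y z : PathAlgebra K V) : (x + y) * z = x * z + y * z :=
  LinearMap.map_add₂ (mulMap K) x y z

theorem mul_add' (x y z : PathAlgebra K V) : x * (y + z) = x * y + x * z :=
  (mulMap K x).map_add y z

theorem zero_mul' (x : PathAlgebra K V) : 0 * x = 0 :=
  LinearMap.map_zero₂ (mulMap K) x

theorem mul_zero' (x : PathAlgebra K V) : x * 0 = 0 :=
  (mulMap K x).map_zero

theorem smul_mul' (c : K) (x y : PathAlgebra K V) : (c • x) * y = c • (x * y) :=
  LinearMap.map_smul₂ (mulMap K) c x y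

theorem mul_smul' (c : K) (x y : PathAlgebra K V) : x * (c • y) = c • (x * y) :=
  (mulMap K x).map_smul c y

theorem pathMul_assoc (p r s : QuiverPath V) :
    pathMul K p r * ofPath K s = ofPath K p * pathMul K r s := by
  obtain ⟨a, b, p⟩ := p
  obtain ⟨c, d, r⟩ := r
  obtain ⟨e, f, s⟩ := s
  by_cases h : c = b
  · subst h
    by_cases h' : e = d
    · subst h'
      simp [pathMul, ofPath_mul_ofPath, Quiver.Path.comp_assoc]
    · simp [pathMul, ofPath_mul_ofPath, h', mul_zero']
  · by_cases h' : e = d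
    · subst h'
      simp [pathMul, ofPath_mul_ofPath, h, zero_mul']
    · simp [pathMul, h, h', zero_mul', mul_zero']

theorem mul_assoc' (x y z : PathAlgebra K V) : x * y * z = x * (y * z) := by
  induction x using induction_on with
  | h0 => simp only [zero_mul']
  | hadd x₁ x₂ h₁ h₂ => simp only [add_mul', h₁, h₂]
  | hof c p =>
    induction y using induction_on with
    | h0 => simp only [zero_mul', mul_zero']
    | hadd y₁ y₂ h₁ h₂ => simp only [add_mul', mul_add', h₁, h₂]
    | hof d r =>
      induction z using induction_on with
      | h0 => simp only [mul_zero']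
      | hadd z₁ z₂ h₁ h₂ => simp only [mul_add', h₁, h₂]
      | hof e s =>
        simp only [smul_mul', mul_smul', ofPath_mul_ofPath, pathMul_assoc]

theorem sum_mul' [Fintype V] (f : V → PathAlgebra K V) (x : PathAlgebra K V) :
    (∑ v, f v) * x = ∑ v, f v * x := by
  change mulMap K (∑ v, f v) x = ∑ v, mulMap K (f v) x
  rw [map_sum, LinearMap.sum_apply]

theorem mul_sum' [Fintype V] (f : V → PathAlgebra K V) (x : PathAlgebra K V) :
    x * (∑ v, f v) = ∑ v, x * f v := by
  change mulMap K x (∑ v, f v) = ∑ v, mulMap K x (f v)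
  rw [map_sum]

theorem one_mul' [Fintype V] (x : PathAlgebra K V) : 1 * x = x := by
  induction x using induction_on with
  | h0 => exact mul_zero' K _
  | hadd x y hx hy => rw [mul_add', hx, hy]
  | hof c p =>
    obtain ⟨a, b, p⟩ := p
    rw [mul_smul']
    congr 1
    change (∑ v : V, ofPath K ⟨v, v, Quiver.Path.nil⟩) * _ = _
    rw [sum_mul', Finset.sum_eq_single a]
    · simp [ofPath_mul_ofPath, pathMul]
    · intro v _ hv
      simp [ofPath_mul_ofPath, pathMul, hv.symm]
    · simp

theorem mul_one' [Fintype V] (x : PathAlgebra K V) : x * 1 = x := by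
  induction x using induction_on with
  | h0 => exact zero_mul' K _
  | hadd x y hx hy => rw [add_mul', hx, hy]
  | hof c p =>
    obtain ⟨a, b, p⟩ := p
    rw [smul_mul']
    congr 1
    change _ * (∑ v : V, ofPath K ⟨v, v, Quiver.Path.nil⟩) = _
    rw [mul_sum', Finset.sum_eq_single b]
    · simp [ofPath_mul_ofPath, pathMul]
    · intro v _ hv
      simp [ofPath_mul_ofPath, pathMul, hv]
    · simp

instance [Fintype V] : Ring (PathAlgebra K V) :=
  { (inferInstance : AddCommGroup (PathAlgebra K V)),
    (inferInstance : Mul (PathAlgebra K V)),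
    (inferInstance : One (PathAlgebra K V)) with
    left_distrib := mul_add' K
    right_distrib := add_mul' K
    zero_mul := zero_mul' K
    mul_zero := mul_zero' K
    mul_assoc := mul_assoc' K
    one_mul := one_mul' K
    mul_one := mul_one' K }

instance [Fintype V] : Algebra K (PathAlgebra K V) :=
  Algebra.ofModule (smul_mul' K) (mul_smul' K)

end PathAlgebra

end PathAlgebra

section SocleDeformation

/-- The vertices `0, 1, …, m - 1` of the quiver `𝒬`, with indices taken modulo `m`. -/
abbrev CyclicVertex (m : ℕ) : Type := ZMod m

/-- The arrows of the quiver `𝒬`: for each `i` modulo `m` an arrow `a i` from `i` to `i + 1` and an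
arrow `abar i` from `i + 1` to `i`. -/
inductive CyclicArrow (m : ℕ) : ZMod m → ZMod m → Type
  | a (i : ZMod m) : CyclicArrow m i (i + 1)
  | abar (i : ZMod m) : CyclicArrow m (i + 1) i

instance (m : ℕ) : Quiver.{0} (CyclicVertex m) := ⟨fun i j => CyclicArrow m i j⟩

variable (K : Type u) [Field K] (m : ℕ)

/-- The arrow `a_i`, as an element of the path algebra `K𝒬`. -/
def arrowA (i : ZMod m) : PathAlgebra K (CyclicVertex m) :=
  PathAlgebra.ofPath K
    ⟨i, i + 1, Quiver.Hom.toPath (V := CyclicVertex m) (CyclicArrow.a i)⟩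

/-- The arrow `ā_i`, as an element of the path algebra `K𝒬`. -/
def arrowAbar (i : ZMod m) : PathAlgebra K (CyclicVertex m) :=
  PathAlgebra.ofPath K
    ⟨i + 1, i, Quiver.Hom.toPath (V := CyclicVertex m) (CyclicArrow.abar i)⟩

variable [NeZero m]

/-- The relations `a_i a_{i+1} = 0`, `ā_{i-1} ā_{i-2} = 0` and `q_i a_i ā_i = ā_{i-1} a_{i-1}`,
whose differences generate the ideal `I_q` of `K𝒬`. -/
inductive SocleRel (q : ZMod m → Kˣ) :
    PathAlgebra K (CyclicVertex m) → PathAlgebra K (CyclicVertex m) → Prop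
  | a_a (i : ZMod m) : SocleRel q (arrowA K m i * arrowA K m (i + 1)) 0
  | abar_abar (i : ZMod m) : SocleRel q (arrowAbar K m (i - 1) * arrowAbar K m (i - 2)) 0
  | a_abar (i : ZMod m) : SocleRel q ((q i : K) • (arrowA K m i * arrowAbar K m i))
      (arrowAbar K m (i - 1) * arrowA K m (i - 1))

/-- The algebra `Λ_q = K𝒬 / I_q`. -/
abbrev SocleDeformation (q : ZMod m → Kˣ) : Type u := RingQuot (SocleRel K m q)

end SocleDeformation

section ExtAlgebra

variable {C : Type*} [Category* C] [Abelian C] [HasExt.{u} C]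

/-- The graded pieces `Ext^n(X, X)`. -/
def SelfExt (X : C) (n : ℕ) : Type u := Abelian.Ext X X n

instance (X : C) (n : ℕ) : AddCommGroup (SelfExt X n) :=
  inferInstanceAs (AddCommGroup (Abelian.Ext X X n))

/-- The Yoneda product `Ext^i(X, X) × Ext^j(X, X) → Ext^(i+j)(X, X)`. -/
instance (X : C) : GradedMonoid.GMul (SelfExt X) where
  mul {i j} α β := (Abelian.Ext.comp (X := X) (Y := X) (Z := X) (a := i) (b := j) α β rfl :)

/-- The identity morphism of `X`, as an element of `Ext^0(X, X)`. -/
instance (X : C) : GradedMonoid.GOne (SelfExt X) where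
  one := (Abelian.Ext.mk₀ (𝟙 X) :)

theorem SelfExt.mk_comp (X : C) {a b c c' : ℕ} (α : Abelian.Ext X X a) (β : Abelian.Ext X X b)
    (h : a + b = c) (h' : a + b = c') :
    @Eq (GradedMonoid (SelfExt X)) ⟨c, α.comp β h⟩ ⟨c', α.comp β h'⟩ := by
  subst h
  subst h'
  rfl

theorem SelfExt.one_mul' (X : C) (i : ℕ) (α : Abelian.Ext X X i) :
    @Eq (GradedMonoid (SelfExt X)) ⟨0 + i, (Abelian.Ext.mk₀ (𝟙 X)).comp α rfl⟩ ⟨i, α⟩ := by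
  rw [SelfExt.mk_comp X _ α rfl (zero_add i), Abelian.Ext.mk₀_id_comp]

theorem SelfExt.mul_one' (X : C) (i : ℕ) (α : Abelian.Ext X X i) :
    @Eq (GradedMonoid (SelfExt X)) ⟨i + 0, α.comp (Abelian.Ext.mk₀ (𝟙 X)) rfl⟩ ⟨i, α⟩ := by
  rw [SelfExt.mk_comp X α _ rfl (add_zero i), Abelian.Ext.comp_mk₀_id]

theorem SelfExt.mul_assoc' (X : C) (i j k : ℕ) (α : Abelian.Ext X X i) (β : Abelian.Ext X X j)
    (γ : Abelian.Ext X X k) :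
    @Eq (GradedMonoid (SelfExt X)) ⟨i + j + k, (α.comp β rfl).comp γ rfl⟩
      ⟨i + (j + k), α.comp (β.comp γ rfl) rfl⟩ := by
  rw [SelfExt.mk_comp X α (β.comp γ rfl) rfl (add_assoc i j k).symm,
    Abelian.Ext.comp_assoc α β γ rfl rfl rfl]

/-- With the Yoneda product, `Ext^*(X, X)` is a graded ring. -/
instance (X : C) : DirectSum.GRing (SelfExt X) where
  mul_zero {i j} α := Abelian.Ext.comp_zero (X := X) (Y := X) (n := i) α X j (i + j) rfl
  zero_mul {i j} β := Abelian.Ext.zero_comp X (n := i) (Y := X) (Z := X) (m := j) β (i + j) rfl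
  mul_add {i j} α β γ := Abelian.Ext.comp_add (X := X) (Y := X) (Z := X) (n := i) (m := j) α β γ rfl
  add_mul {i j} α β γ := Abelian.Ext.add_comp (X := X) (Y := X) (Z := X) (n := i) (m := j) α β γ rfl
  one_mul := fun ⟨i, α⟩ => SelfExt.one_mul' X i α
  mul_one := fun ⟨i, α⟩ => SelfExt.mul_one' X i α
  mul_assoc := fun ⟨i, α⟩ ⟨j, β⟩ ⟨k, γ⟩ => SelfExt.mul_assoc' X i j k α β γ
  natCast n := n • GradedMonoid.GOne.one
  natCast_zero := zero_smul _ _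
  natCast_succ n := succ_nsmul _ _
  intCast n := n • GradedMonoid.GOne.one
  intCast_ofNat n := natCast_zsmul _ _
  intCast_negSucc_ofNat n := negSucc_zsmul _ _

end ExtAlgebra

section ExtAlgebraOfRing

/-- The left module `Γ / 𝔯`, where `𝔯` is the Jacobson radical of `Γ`. -/
abbrev radicalQuotient (Γ : Type u) [Ring Γ] : ModuleCat.{u} Γ :=
  ModuleCat.of Γ (Γ ⧸ Ring.jacobson Γ)

/-- The Ext algebra `E(Γ) = ⨁ n, Ext^n_Γ(Γ / 𝔯, Γ / 𝔯)`, with the Yoneda product. -/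
abbrev ExtAlgebra (Γ : Type u) [Ring Γ] : Type u :=
  ⨁ n : ℕ, SelfExt (radicalQuotient Γ) n

/-- The graded centre `Z_gr(E(Γ))`: the subring of `E(Γ)` generated by the homogeneous elements
`z`, of degree `n` say, with `z g = (-1)^(m n) g z` for all `m` and all homogeneous `g` of
degree `m`. -/
def gradedCentre (Γ : Type u) [Ring Γ] : Subring (ExtAlgebra Γ) :=
  Subring.closure {z | ∃ (n : ℕ) (x : SelfExt (radicalQuotient Γ) n),
    z = DirectSum.of (SelfExt (radicalQuotient Γ)) n x ∧
    ∀ (m : ℕ) (g : SelfExt (radicalQuotient Γ) m),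
      z * DirectSum.of (SelfExt (radicalQuotient Γ)) m g =
        (-1) ^ (m * n) * (DirectSum.of (SelfExt (radicalQuotient Γ)) m g * z)}

end ExtAlgebraOfRing

end

/-!
The statement is reduced to a computation with monomials in two variables.

Let `R = K ^ (ℤ / m)`, let `σ` be the shift of indices, and let `x` and `y` be the sums of the
arrows `a i` and of the arrows `ā i`. Then `Λ_q` is a quantum exterior algebra over `R`: it is
free as a left `R`-module on `1, x, y, xy`, with `x² = y² = 0`, `yx = q xy`, `x r = σ(r) x` and
`y r = σ⁻¹(r) y` (`socleQuantumExterior`). The relations give spanning; independence comes from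
letting `Λ_q` act on `R⁴` by the formulas for the left regular representation.

For any such ring `Γ` with radical `𝔯`, put `S = Γ / 𝔯`, `M = Γ / Γy` and `N = Γ / Γx`. The short
exact sequences `0 → S → M → S → 0` and `0 → S → N → S → 0`, whose first maps are right
multiplication by `x` and by `y`, define classes `α` and `β` in `Ext¹(S, S)`. No projective
resolution of `S` is needed to describe the Ext algebra:

* `M` is its own first syzygy, by `0 → M → Γ → M → 0`. Hence every class in `Extⁿ(M, S)` is the
  restriction of `βⁿ r` for a unique `r ∈ R`. The long exact sequence of `0 → S → M → S → 0` then
  shows that every class of positive degree `n` is `α g + βⁿ r` for unique `g` and `r`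
  (`exists_extX_comp_add`, `extX_comp_add_eq_zero`), so the `α ^ s β ^ t` form a basis over `R`.
* Naturality of the connecting class gives `r α = α σ(r)` and `r β = β σ⁻¹(r)`, and
  `β α = - α β q` (`extY_comp_extX`). For the last one, both products factor through `0 → 𝔯 → Γ → S → 0`, and
  the other factors are the two images of the single extension `0 → S → N ⊕ M → 𝔯 → 0` expressing
  the relation `yx = q xy`; this is the source of the sign.

So the Ext algebra is a quantum plane with parameter `c = -q` (`quantumPlane`), for which the
assertion is `QuantumPlane.finite_iff`. Moving `α` through `β ^ t` all around the cycle costs the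
scalar `(∏ c) ^ t`, and symmetrically for `β` and `α ^ s`. If `∏ c` is not a root of unity, no
nonzero element of positive degree is graded central, so the graded centre lies in degree zero,
while the Ext algebra is nonzero in every degree. If it is a root of unity, suitable even powers
of `α` and `β` are central and the monomials of small degree generate over them. Finally
`∏ c = ± ∏ q`.
-/

noncomputable section

/-! ### Quantum exterior algebras -/

/-- Elements of a ring `Γ` satisfying the relations of a quantum exterior algebra in two variables
`x`, `y` over a commutative ring `R`, twisted by an automorphism `σ` of `R` and with commutation
parameter `q`: the squares of `x` and `y` vanish, `yx = q xy`, and `x`, `y` are moved past scalars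
by `σ` and `σ⁻¹`. -/
structure QuantumRel (R Γ : Type*) [CommRing R] [Ring Γ] (σ : R ≃+* R) (q : Rˣ) where
  ι : R →+* Γ
  x : Γ
  y : Γ
  x_mul_ι (r : R) : x * ι r = ι (σ r) * x
  y_mul_ι (r : R) : y * ι r = ι (σ.symm r) * y
  x_mul_x : x * x = 0
  y_mul_y : y * y = 0
  y_mul_x : y * x = ι q * (x * y)

/-- A presentation of a ring `Γ` as a quantum exterior algebra: moreover `Γ` is a free left
`R`-module on `1, x, y, xy`. -/
structure QuantumExterior (R Γ : Type*) [CommRing R] [Ring Γ] (σ : R ≃+* R) (q : Rˣ) extends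
    QuantumRel R Γ σ q where
  /-- The coordinates in the left basis `1, x, y, xy`. -/
  coord : Γ ≃ R × R × R × R
  coord_symm (a b c d : R) :
    coord.symm (a, b, c, d) = ι a + ι b * x + ι c * y + ι d * (x * y)

namespace QuantumRel

variable {R Γ : Type*} [CommRing R] [Ring Γ] {σ : R ≃+* R} {q : Rˣ} (P : QuantumRel R Γ σ q)

/-- The combination of `1, x, y, xy` with left coefficients `a, b, c, d`. -/
def elem (a b c d : R) : Γ := P.ι a + P.ι b * P.x + P.ι c * P.y + P.ι d * (P.x * P.y)

theorem elem_zero : P.elem 0 0 0 0 = 0 := by simp [elem]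

theorem elem_add (a b c d a' b' c' d' : R) :
    P.elem a b c d + P.elem a' b' c' d' = P.elem (a + a') (b + b') (c + c') (d + d') := by
  simp only [elem, map_add, add_mul]
  abel

theorem ι_eq_elem (r : R) : P.ι r = P.elem r 0 0 0 := by simp [elem]

theorem x_eq_elem : P.x = P.elem 0 1 0 0 := by simp [elem]

theorem y_eq_elem : P.y = P.elem 0 0 1 0 := by simp [elem]

theorem elem_mul_x (a b c d : R) : P.elem a b c d * P.x = P.elem 0 a 0 (c * q) := by
  have h : P.x * (P.ι q * (P.x * P.y)) = 0 := by
    rw [← mul_assoc, P.x_mul_ι, mul_assoc, ← mul_assoc P.x, P.x_mul_x]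
    simp
  simp [elem, add_mul, mul_assoc, P.x_mul_x, h, P.y_mul_x]

theorem elem_mul_y (a b c d : R) : P.elem a b c d * P.y = P.elem 0 0 a b := by
  simp [elem, add_mul, mul_assoc, P.y_mul_y]

theorem elem_mul_ι (a b c d r : R) :
    P.elem a b c d * P.ι r = P.elem (a * r) (b * σ r) (c * σ.symm r) (d * r) := by
  have h : P.x * (P.ι (σ.symm r) * P.y) = P.ι r * (P.x * P.y) := by
    rw [← mul_assoc, P.x_mul_ι, mul_assoc, RingEquiv.apply_symm_apply]
  simp [elem, add_mul, mul_assoc, P.x_mul_ι, P.y_mul_ι, h]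

end QuantumRel

namespace QuantumExterior

open QuantumRel

variable {R Γ : Type*} [CommRing R] [Ring Γ] {σ : R ≃+* R} {q : Rˣ}
  (P : QuantumExterior R Γ σ q)

theorem coord_elem (a b c d : R) : P.coord (P.elem a b c d) = (a, b, c, d) := by
  rw [elem, ← P.coord_symm, Equiv.apply_symm_apply]

theorem exists_elem (g : Γ) : ∃ a b c d, g = P.elem a b c d := by
  obtain ⟨⟨a, b, c, d⟩, rfl⟩ := P.coord.symm.surjective g
  exact ⟨a, b, c, d, P.coord_symm a b c d⟩

theorem elem_inj {a b c d a' b' c' d' : R} :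
    P.elem a b c d = P.elem a' b' c' d' ↔ a = a' ∧ b = b' ∧ c = c' ∧ d = d' := by
  rw [← P.coord.injective.eq_iff, P.coord_elem, P.coord_elem]
  simp

theorem elem_eq_zero {a b c d : R} :
    P.elem a b c d = 0 ↔ a = 0 ∧ b = 0 ∧ c = 0 ∧ d = 0 := by
  rw [← P.elem_zero, P.elem_inj]

/-- The augmentation `Γ → R`, killing `x` and `y`. -/
def aug : Γ →+* R where
  toFun g := (P.coord g).1
  map_one' := by rw [← map_one P.ι, P.ι_eq_elem, P.coord_elem]
  map_zero' := by rw [← P.elem_zero, P.coord_elem]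
  map_add' g h := by
    obtain ⟨a, b, c, d, rfl⟩ := P.exists_elem g
    obtain ⟨a', b', c', d', rfl⟩ := P.exists_elem h
    simp only [P.elem_add, P.coord_elem]
  map_mul' g h := by
    obtain ⟨a, b, c, d, rfl⟩ := P.exists_elem g
    obtain ⟨a', b', c', d', rfl⟩ := P.exists_elem h
    conv_lhs => rw [elem.eq_def P.toQuantumRel a' b' c' d']
    simp only [mul_add, ← mul_assoc, P.elem_mul_ι, P.elem_mul_x, P.elem_mul_y, P.elem_add,
      P.coord_elem, add_zero]

theorem aug_elem (a b c d : R) : P.aug (P.elem a b c d) = a := by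
  change (P.coord _).1 = a
  rw [P.coord_elem]

theorem aug_ι (r : R) : P.aug (P.ι r) = r := by rw [P.ι_eq_elem, P.aug_elem]

theorem aug_x : P.aug P.x = 0 := by rw [P.x_eq_elem, P.aug_elem]

theorem aug_y : P.aug P.y = 0 := by rw [P.y_eq_elem, P.aug_elem]

theorem mul_mul_mul_eq_zero_of_aug {g : Γ} (hg : P.aug g = 0) : g * g * g = 0 := by
  obtain ⟨a, b, c, d, rfl⟩ := P.exists_elem g
  rw [P.aug_elem] at hg
  subst hg
  conv_lhs => rw [elem.eq_def P.toQuantumRel 0 b c d]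
  rw [← elem.eq_def, mul_assoc]
  conv_lhs => enter [2, 2]; rw [elem]
  conv_lhs =>
    enter [2]
    simp only [mul_add, ← mul_assoc, P.elem_mul_ι, P.elem_mul_x, P.elem_mul_y, P.elem_add]
  simp only [zero_mul, add_zero, zero_add, mul_zero]
  conv_lhs => enter [2]; rw [elem]
  simp only [mul_add, ← mul_assoc, P.elem_mul_ι, P.elem_mul_x, P.elem_mul_y, P.elem_add]
  simp [P.elem_zero]

theorem mem_span_x {g : Γ} : g ∈ Ideal.span {P.x} ↔ ∃ b d, g = P.elem 0 b 0 d := by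
  rw [Ideal.mem_span_singleton']
  constructor
  · rintro ⟨h, rfl⟩
    obtain ⟨a, b, c, d, rfl⟩ := P.exists_elem h
    exact ⟨_, _, P.elem_mul_x ..⟩
  · rintro ⟨b, d, rfl⟩
    refine ⟨P.elem b 0 (d * ↑q⁻¹) 0, ?_⟩
    rw [P.elem_mul_x, mul_assoc, Units.inv_mul, mul_one]

theorem mem_span_y {g : Γ} : g ∈ Ideal.span {P.y} ↔ ∃ c d, g = P.elem 0 0 c d := by
  rw [Ideal.mem_span_singleton']
  constructor
  · rintro ⟨h, rfl⟩
    obtain ⟨a, b, c, d, rfl⟩ := P.exists_elem h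
    exact ⟨_, _, P.elem_mul_y ..⟩
  · rintro ⟨c, d, rfl⟩
    exact ⟨P.elem c d 0 0, P.elem_mul_y ..⟩

/-- The Jacobson radical is the kernel of the augmentation: the quotient `R` is semisimple, and the
elements of the kernel have vanishing cube. -/
theorem mem_jacobson [IsSemisimpleRing R] {g : Γ} : g ∈ Ring.jacobson Γ ↔ P.aug g = 0 := by
  have : RingHomSurjective P.aug := ⟨fun r => ⟨P.ι r, P.aug_ι r⟩⟩
  constructor
  · intro hg
    have := Ring.le_comap_jacobson P.aug hg
    rwa [Ideal.mem_comap, IsSemisimpleRing.jacobson_eq_bot, Ideal.mem_bot] at this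
  · intro hg
    rw [Ring.jacobson_eq_sInf_isMaximal, Ideal.mem_sInf]
    intro I hI
    by_contra hgI
    obtain ⟨l, i, hi, h⟩ := hI.exists_inv hgI
    -- With `h = l g`, the inverse of `1 - h` is `1 + h + h ^ 2`, as `h ^ 3 = 0`.
    have h3 : l * g * (l * g) * (l * g) = 0 :=
      P.mul_mul_mul_eq_zero_of_aug (by rw [map_mul, hg, mul_zero])
    have h1 : (1 + l * g + l * g * (l * g)) * i = 1 := by
      calc (1 + l * g + l * g * (l * g)) * i
          = (1 + l * g + l * g * (l * g)) * (1 - l * g) := by rw [← h, add_sub_cancel_left]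
        _ = 1 - l * g * (l * g) * (l * g) := by noncomm_ring
        _ = 1 := by rw [h3, sub_zero]
    exact hI.ne_top ((Ideal.eq_top_iff_one I).mpr (h1 ▸ I.mul_mem_left _ hi))

end QuantumExterior

/-! ### Ext classes of short exact sequences of modules -/

section LinearExt

open Abelian

variable {Γ : Type u} [Ring Γ] {A B C : Type u} [AddCommGroup A] [AddCommGroup B]
  [AddCommGroup C] [Module Γ A] [Module Γ B] [Module Γ C]

/-- A pair of linear maps forming a short exact sequence `0 → A → B → C → 0`. -/
structure ShortExactPair (f : A →ₗ[Γ] B) (g : B →ₗ[Γ] C) : Prop where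
  injective : Function.Injective f
  exact : Function.Exact f g
  surjective : Function.Surjective g

/-- A linear map, as an element of `Ext⁰`. -/
def extOfLinear (f : A →ₗ[Γ] B) : Ext.{u} (ModuleCat.of Γ A) (ModuleCat.of Γ B) 0 :=
  Ext.mk₀ (ModuleCat.ofHom f)

theorem extOfLinear_comp (f : A →ₗ[Γ] B) (g : B →ₗ[Γ] C) :
    (extOfLinear f).comp (extOfLinear g) (zero_add 0) = extOfLinear (g ∘ₗ f) :=
  Ext.mk₀_comp_mk₀ _ _

theorem exists_extOfLinear (e : Ext.{u} (ModuleCat.of Γ A) (ModuleCat.of Γ B) 0) :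
    ∃ f : A →ₗ[Γ] B, e = extOfLinear f := by
  obtain ⟨f, rfl⟩ := (Ext.mk₀_bijective _ _).surjective e
  exact ⟨f.hom, rfl⟩

theorem extOfLinear_eq_zero {f : A →ₗ[Γ] B} : extOfLinear f = 0 ↔ f = 0 := by
  rw [extOfLinear, Ext.mk₀_eq_zero_iff]
  exact ⟨fun h => congrArg ModuleCat.Hom.hom h, fun h => h ▸ rfl⟩

theorem extOfLinear_add (f g : A →ₗ[Γ] B) :
    extOfLinear (f + g) = extOfLinear f + extOfLinear g :=
  Ext.mk₀_add _ _

namespace ShortExactPair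

variable {f : A →ₗ[Γ] B} {g : B →ₗ[Γ] C} (h : ShortExactPair f g)

include h in
theorem shortExact : (ModuleCat.shortComplexOfCompEqZero f g
    h.exact.linearMap_comp_eq_zero).ShortExact :=
  ModuleCat.shortComplex_shortExact _ h.exact h.injective h.surjective

/-- The class in `Ext¹` of a short exact sequence of modules. -/
def extClass : Ext.{u} (ModuleCat.of Γ C) (ModuleCat.of Γ A) 1 := h.shortExact.extClass

theorem extOfLinear_comp_extClass :
    (extOfLinear g).comp h.extClass (zero_add 1) = 0 :=
  h.shortExact.comp_extClass

theorem exists_of_extClass_comp_eq_zero {Y : ModuleCat.{u} Γ} {n n' : ℕ} (hn : 1 + n = n')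
    (e : Ext (ModuleCat.of Γ A) Y n) (he : h.extClass.comp e hn = 0) :
    ∃ e' : Ext (ModuleCat.of Γ B) Y n, (extOfLinear f).comp e' (zero_add n) = e :=
  Ext.contravariant_sequence_exact₁ h.shortExact Y e hn he

theorem exists_of_extOfLinear_comp_eq_zero {Y : ModuleCat.{u} Γ} {n n' : ℕ} (hn : 1 + n = n')
    (e : Ext (ModuleCat.of Γ C) Y n') (he : (extOfLinear g).comp e (zero_add n') = 0) :
    ∃ e' : Ext (ModuleCat.of Γ A) Y n, h.extClass.comp e' hn = e :=
  Ext.contravariant_sequence_exact₃ h.shortExact Y e he hn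

theorem extClass_naturality {A' B' C' : Type u} [AddCommGroup A'] [AddCommGroup B']
    [AddCommGroup C'] [Module Γ A'] [Module Γ B'] [Module Γ C'] {f' : A' →ₗ[Γ] B'}
    {g' : B' →ₗ[Γ] C'} (h' : ShortExactPair f' g') (a : A →ₗ[Γ] A') (b : B →ₗ[Γ] B')
    (c : C →ₗ[Γ] C') (hab : f' ∘ₗ a = b ∘ₗ f) (hbc : g' ∘ₗ b = c ∘ₗ g) :
    h.extClass.comp (extOfLinear a) (add_zero 1) =
      (extOfLinear c).comp h'.extClass (zero_add 1) :=
  ShortComplex.ShortExact.extClass_naturality h.shortExact h'.shortExact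
    { τ₁ := ModuleCat.ofHom a
      τ₂ := ModuleCat.ofHom b
      τ₃ := ModuleCat.ofHom c
      comm₁₂ := by
        ext t
        exact LinearMap.congr_fun hab t
      comm₂₃ := by
        ext t
        exact LinearMap.congr_fun hbc t }

end ShortExactPair

end LinearExt

section MulRight

variable {Γ : Type u} [Ring Γ]

/-- Right multiplication by `s`, as a map of left modules `Γ ⧸ I → Γ ⧸ I'`. -/
def mulRightQuot (I I' : Ideal Γ) (s : Γ) (h : ∀ g ∈ I, g * s ∈ I') : (Γ ⧸ I) →ₗ[Γ] (Γ ⧸ I') :=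
  Submodule.mapQ I I' (LinearMap.toSpanSingleton Γ Γ s) h

@[simp]
theorem mulRightQuot_mk (I I' : Ideal Γ) (s : Γ) (h : ∀ g ∈ I, g * s ∈ I') (g : Γ) :
    mulRightQuot I I' s h (Submodule.Quotient.mk g) = Submodule.Quotient.mk (g * s) := rfl

theorem mulRightQuot_injective (I I' : Ideal Γ) (s : Γ) (h : ∀ g, g ∈ I ↔ g * s ∈ I') :
    Function.Injective (mulRightQuot I I' s fun g => (h g).mp) := by
  rw [injective_iff_map_eq_zero]
  intro t
  obtain ⟨g, rfl⟩ := Submodule.Quotient.mk_surjective _ t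
  rw [mulRightQuot_mk, Submodule.Quotient.mk_eq_zero, Submodule.Quotient.mk_eq_zero]
  exact (h g).mpr

/-- Left linear maps out of `Γ ⧸ I` are equal as soon as they agree on the class of `1`. -/
theorem quot_hom_ext {I : Ideal Γ} {A : Type*} [AddCommGroup A] [Module Γ A]
    {f g : (Γ ⧸ I) →ₗ[Γ] A}
    (h : f (Submodule.Quotient.mk 1) = g (Submodule.Quotient.mk 1)) : f = g := by
  refine LinearMap.ext fun t => ?_
  obtain ⟨t, rfl⟩ := Submodule.Quotient.mk_surjective _ t
  have ht : (Submodule.Quotient.mk t : Γ ⧸ I) = t • Submodule.Quotient.mk 1 := by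
    rw [← Submodule.Quotient.mk_smul, smul_eq_mul, mul_one]
  rw [ht, map_smul, map_smul, h]

theorem shortExactPair_subtype_mkQ (I : Ideal Γ) :
    ShortExactPair (Submodule.subtype I) (Submodule.mkQ I) :=
  ⟨Submodule.subtype_injective _, LinearMap.exact_subtype_mkQ _, Submodule.mkQ_surjective _⟩

end MulRight

namespace QuantumExterior

open Abelian

variable {R : Type*} {Γ : Type u} [CommRing R] [Ring Γ] {σ : R ≃+* R}
  {q : Rˣ} (P : QuantumExterior R Γ σ q)

/-- The module `M = Γ / Γy`. -/
abbrev ModM : Type u := Γ ⧸ Ideal.span {P.y}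

/-- The module `N = Γ / Γx`. -/
abbrev ModN : Type u := Γ ⧸ Ideal.span {P.x}

/-- The isomorphism of `M = Γ / Γy` with `Γy`, induced by right multiplication by `y`. -/
def mulY : P.ModM →ₗ[Γ] Γ :=
  Submodule.liftQ _ (LinearMap.toSpanSingleton Γ Γ P.y) fun g hg => by
    obtain ⟨c, d, rfl⟩ := P.mem_span_y.mp hg
    rw [LinearMap.mem_ker, LinearMap.toSpanSingleton_apply, smul_eq_mul, P.elem_mul_y, P.elem_zero]

/-- The isomorphism of `N = Γ / Γx` with `Γx`, induced by right multiplication by `x`. -/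
def mulX : P.ModN →ₗ[Γ] Γ :=
  Submodule.liftQ _ (LinearMap.toSpanSingleton Γ Γ P.x) fun g hg => by
    obtain ⟨c, d, rfl⟩ := P.mem_span_x.mp hg
    rw [LinearMap.mem_ker, LinearMap.toSpanSingleton_apply, smul_eq_mul, P.elem_mul_x, zero_mul,
      P.elem_zero]

@[simp]
theorem mulY_mk (g : Γ) : P.mulY (Submodule.Quotient.mk g) = g * P.y := rfl

@[simp]
theorem mulX_mk (g : Γ) : P.mulX (Submodule.Quotient.mk g) = g * P.x := rfl

/-- The first step of the periodic resolution of `M`: its syzygy is `M` again. -/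
theorem shortExact_periodic :
    ShortExactPair P.mulY (Submodule.mkQ (Ideal.span {P.y})) := by
  refine ⟨?_, fun g => ?_, Submodule.mkQ_surjective _⟩
  · rw [injective_iff_map_eq_zero]
    intro t
    obtain ⟨g, rfl⟩ := Submodule.Quotient.mk_surjective _ t
    obtain ⟨a, b, c, d, rfl⟩ := P.exists_elem g
    rw [mulY_mk, P.elem_mul_y, P.elem_eq_zero, Submodule.Quotient.mk_eq_zero, P.mem_span_y]
    rintro ⟨-, -, rfl, rfl⟩
    exact ⟨_, _, rfl⟩
  · rw [Submodule.mkQ_apply, Submodule.Quotient.mk_eq_zero, Ideal.mem_span_singleton']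
    constructor
    · rintro ⟨h, rfl⟩
      exact ⟨Submodule.Quotient.mk h, rfl⟩
    · rintro ⟨t, rfl⟩
      obtain ⟨h, rfl⟩ := Submodule.Quotient.mk_surjective _ t
      exact ⟨h, rfl⟩

/-- The semisimple module `Γ / 𝔯`. -/
abbrev TopQuot (Γ : Type u) [Ring Γ] : Type u := Γ ⧸ Ring.jacobson Γ

/-- Right multiplication by a scalar on `Γ / 𝔯`; these are all the endomorphisms of this left
module, by `exists_scalar`. -/
def scalar (r : R) : TopQuot Γ →ₗ[Γ] TopQuot Γ :=
  mulRightQuot _ _ (P.ι r) fun _ h => Ideal.mul_mem_right _ _ h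

theorem scalar_add (r s : R) : P.scalar (r + s) = P.scalar r + P.scalar s := by
  refine quot_hom_ext ?_
  change Submodule.Quotient.mk (p := Ring.jacobson Γ) (1 * P.ι (r + s)) =
    Submodule.Quotient.mk (1 * P.ι r) + Submodule.Quotient.mk (1 * P.ι s)
  rw [map_add, mul_add, Submodule.Quotient.mk_add]

theorem scalar_neg (r : R) : P.scalar (-r) = -P.scalar r := by
  refine quot_hom_ext ?_
  change Submodule.Quotient.mk (p := Ring.jacobson Γ) (1 * P.ι (-r)) =
    -Submodule.Quotient.mk (1 * P.ι r)
  rw [map_neg, mul_neg, Submodule.Quotient.mk_neg]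

theorem scalar_comp (r s : R) : P.scalar s ∘ₗ P.scalar r = P.scalar (r * s) := by
  refine quot_hom_ext ?_
  change Submodule.Quotient.mk (1 * P.ι r * P.ι s) = Submodule.Quotient.mk (1 * P.ι (r * s))
  rw [map_mul, one_mul, one_mul]

theorem scalar_one : P.scalar 1 = LinearMap.id := by
  refine quot_hom_ext ?_
  change Submodule.Quotient.mk (p := Ring.jacobson Γ) (1 * P.ι 1) = Submodule.Quotient.mk 1
  rw [map_one, mul_one]

variable [IsSemisimpleRing R]

theorem mem_jacobson_iff_exists {g : Γ} :
    g ∈ Ring.jacobson Γ ↔ ∃ b c d, g = P.elem 0 b c d := by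
  obtain ⟨a, b, c, d, rfl⟩ := P.exists_elem g
  simp only [P.mem_jacobson, P.aug_elem, P.elem_inj]
  constructor
  · rintro rfl
    exact ⟨b, c, d, rfl, rfl, rfl, rfl⟩
  · rintro ⟨_, _, _, h, -⟩
    exact h

/-- The inclusion `Γ / 𝔯 → M` onto the submodule generated by `x`. -/
def inclM : TopQuot Γ →ₗ[Γ] P.ModM :=
  mulRightQuot _ _ P.x fun g hg => by
    obtain ⟨b, c, d, rfl⟩ := P.mem_jacobson_iff_exists.mp hg
    rw [P.elem_mul_x, P.mem_span_y]
    exact ⟨_, _, rfl⟩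

/-- The projection `M → Γ / 𝔯`. -/
def projM : P.ModM →ₗ[Γ] TopQuot Γ :=
  mulRightQuot _ _ 1 fun g hg => by
    obtain ⟨c, d, rfl⟩ := P.mem_span_y.mp hg
    rw [mul_one, P.mem_jacobson, P.aug_elem]

/-- The inclusion `Γ / 𝔯 → N` onto the submodule generated by `y`. -/
def inclN : TopQuot Γ →ₗ[Γ] P.ModN :=
  mulRightQuot _ _ P.y fun g hg => by
    obtain ⟨b, c, d, rfl⟩ := P.mem_jacobson_iff_exists.mp hg
    rw [P.elem_mul_y, P.mem_span_x]
    exact ⟨_, _, rfl⟩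

/-- The projection `N → Γ / 𝔯`. -/
def projN : P.ModN →ₗ[Γ] TopQuot Γ :=
  mulRightQuot _ _ 1 fun g hg => by
    obtain ⟨c, d, rfl⟩ := P.mem_span_x.mp hg
    rw [mul_one, P.mem_jacobson, P.aug_elem]

theorem shortExact_M : ShortExactPair P.inclM P.projM := by
  refine ⟨mulRightQuot_injective _ _ _ fun g => ?_, fun t => ?_, fun t => ?_⟩
  · obtain ⟨a, b, c, d, rfl⟩ := P.exists_elem g
    simp [P.elem_mul_x, P.mem_span_y, P.mem_jacobson, P.aug_elem, P.elem_inj]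
  · obtain ⟨g, rfl⟩ := Submodule.Quotient.mk_surjective _ t
    obtain ⟨a, b, c, d, rfl⟩ := P.exists_elem g
    simp only [projM, mulRightQuot_mk, mul_one, Set.mem_range]
    rw [Submodule.Quotient.mk_eq_zero, P.mem_jacobson, P.aug_elem]
    constructor
    · rintro rfl
      refine ⟨Submodule.Quotient.mk (P.ι b), ?_⟩
      rw [inclM, mulRightQuot_mk, Submodule.Quotient.eq', P.mem_span_y, P.ι_eq_elem, P.elem_mul_x]
      refine ⟨c, d, ?_⟩
      rw [neg_add_eq_iff_eq_add, P.elem_add]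
      simp
    · rintro ⟨t, ht⟩
      obtain ⟨g, rfl⟩ := Submodule.Quotient.mk_surjective _ t
      obtain ⟨a', b', c', d', rfl⟩ := P.exists_elem g
      rw [inclM, mulRightQuot_mk, Submodule.Quotient.eq', P.mem_span_y, P.elem_mul_x] at ht
      obtain ⟨c₁, d₁, h⟩ := ht
      rw [neg_add_eq_iff_eq_add, P.elem_add, P.elem_inj] at h
      simpa using h.1
  · obtain ⟨g, rfl⟩ := Submodule.Quotient.mk_surjective _ t
    exact ⟨Submodule.Quotient.mk g, by rw [projM, mulRightQuot_mk, mul_one]⟩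

theorem shortExact_N : ShortExactPair P.inclN P.projN := by
  refine ⟨mulRightQuot_injective _ _ _ fun g => ?_, fun t => ?_, fun t => ?_⟩
  · obtain ⟨a, b, c, d, rfl⟩ := P.exists_elem g
    simp [P.elem_mul_y, P.mem_span_x, P.mem_jacobson, P.aug_elem, P.elem_inj]
  · obtain ⟨g, rfl⟩ := Submodule.Quotient.mk_surjective _ t
    obtain ⟨a, b, c, d, rfl⟩ := P.exists_elem g
    simp only [projN, mulRightQuot_mk, mul_one, Set.mem_range]
    rw [Submodule.Quotient.mk_eq_zero, P.mem_jacobson, P.aug_elem]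
    constructor
    · rintro rfl
      refine ⟨Submodule.Quotient.mk (P.ι c), ?_⟩
      rw [inclN, mulRightQuot_mk, Submodule.Quotient.eq', P.mem_span_x, P.ι_eq_elem, P.elem_mul_y]
      refine ⟨b, d, ?_⟩
      rw [neg_add_eq_iff_eq_add, P.elem_add]
      simp
    · rintro ⟨t, ht⟩
      obtain ⟨g, rfl⟩ := Submodule.Quotient.mk_surjective _ t
      obtain ⟨a', b', c', d', rfl⟩ := P.exists_elem g
      rw [inclN, mulRightQuot_mk, Submodule.Quotient.eq', P.mem_span_x, P.elem_mul_y] at ht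
      obtain ⟨c₁, d₁, h⟩ := ht
      rw [neg_add_eq_iff_eq_add, P.elem_add, P.elem_inj] at h
      simpa using h.1
  · obtain ⟨g, rfl⟩ := Submodule.Quotient.mk_surjective _ t
    exact ⟨Submodule.Quotient.mk g, by rw [projN, mulRightQuot_mk, mul_one]⟩

end QuantumExterior

/-! ### The Ext algebra of a quantum exterior algebra -/

namespace QuantumExterior

open Abelian

section

variable {R : Type*} {Γ : Type*} [CommRing R] [Ring Γ] {σ : R ≃+* R}
  {q : Rˣ} (P : QuantumExterior R Γ σ q)

/-- On the radical, left multiplication acts on the coefficients of `x` and `y` through the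
augmentation. -/
theorem exists_mul_elem (g : Γ) (b c d : R) :
    ∃ d', g * P.elem 0 b c d = P.elem 0 (P.aug g * b) (P.aug g * c) d' := by
  obtain ⟨a', b', c', d', rfl⟩ := P.exists_elem g
  rw [P.aug_elem]
  conv =>
    enter [1, _, 1, 2]
    rw [QuantumRel.elem]
  simp only [mul_add, ← mul_assoc, P.elem_mul_ι, P.elem_mul_x, P.elem_mul_y, P.elem_add]
  refine ⟨_, P.elem_inj.mpr ⟨?_, ?_, ?_, rfl⟩⟩ <;> simp

end

variable {R : Type*} {Γ : Type u} [CommRing R] [Ring Γ] {σ : R ≃+* R}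
  {q : Rˣ} (P : QuantumExterior R Γ σ q) [IsSemisimpleRing R]

/-- The coefficient of `x` of an element of the radical, as a linear map to `Γ / 𝔯`. -/
def coeffX : Ring.jacobson Γ →ₗ[Γ] TopQuot Γ where
  toFun j := Submodule.Quotient.mk (P.ι (P.coord j).2.1)
  map_add' j k := by
    obtain ⟨j, hj⟩ := j
    obtain ⟨k, hk⟩ := k
    obtain ⟨a, b, c, rfl⟩ := P.mem_jacobson_iff_exists.mp hj
    obtain ⟨a', b', c', rfl⟩ := P.mem_jacobson_iff_exists.mp hk
    simp only [AddMemClass.mk_add_mk, P.elem_add, P.coord_elem, map_add, Submodule.Quotient.mk_add]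
  map_smul' g j := by
    obtain ⟨j, hj⟩ := j
    obtain ⟨a, b, c, rfl⟩ := P.mem_jacobson_iff_exists.mp hj
    obtain ⟨d, hd⟩ := P.exists_mul_elem g a b c
    simp only [SetLike.mk_smul_mk, smul_eq_mul, hd, P.coord_elem, RingHom.id_apply]
    rw [← Submodule.Quotient.mk_smul, Submodule.Quotient.eq', P.mem_jacobson]
    simp [P.aug_ι]

/-- The coefficient of `y` of an element of the radical, as a linear map to `Γ / 𝔯`. -/
def coeffY : Ring.jacobson Γ →ₗ[Γ] TopQuot Γ where
  toFun j := Submodule.Quotient.mk (P.ι (P.coord j).2.2.1)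
  map_add' j k := by
    obtain ⟨j, hj⟩ := j
    obtain ⟨k, hk⟩ := k
    obtain ⟨a, b, c, rfl⟩ := P.mem_jacobson_iff_exists.mp hj
    obtain ⟨a', b', c', rfl⟩ := P.mem_jacobson_iff_exists.mp hk
    simp only [AddMemClass.mk_add_mk, P.elem_add, P.coord_elem, map_add, Submodule.Quotient.mk_add]
  map_smul' g j := by
    obtain ⟨j, hj⟩ := j
    obtain ⟨a, b, c, rfl⟩ := P.mem_jacobson_iff_exists.mp hj
    obtain ⟨d, hd⟩ := P.exists_mul_elem g a b c
    simp only [SetLike.mk_smul_mk, smul_eq_mul, hd, P.coord_elem, RingHom.id_apply]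
    rw [← Submodule.Quotient.mk_smul, Submodule.Quotient.eq', P.mem_jacobson]
    simp [P.aug_ι]

theorem coeffX_mk {b c d : R} (h : P.elem 0 b c d ∈ Ring.jacobson Γ) :
    P.coeffX ⟨P.elem 0 b c d, h⟩ = Submodule.Quotient.mk (P.ι b) := by
  change Submodule.Quotient.mk (P.ι (P.coord _).2.1) = _
  rw [P.coord_elem]

theorem coeffY_mk {b c d : R} (h : P.elem 0 b c d ∈ Ring.jacobson Γ) :
    P.coeffY ⟨P.elem 0 b c d, h⟩ = Submodule.Quotient.mk (P.ι c) := by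
  change Submodule.Quotient.mk (P.ι (P.coord _).2.2.1) = _
  rw [P.coord_elem]

/-- The projective cover `N ⊕ M → Γx + Γy` modulo the syzygies of `Γx` and `Γy`. -/
def mulXY : (P.ModN × P.ModM) →ₗ[Γ] Ring.jacobson Γ :=
  LinearMap.codRestrict _ (P.mulX.coprod P.mulY) fun t => by
    obtain ⟨t, s⟩ := t
    obtain ⟨g, rfl⟩ := Submodule.Quotient.mk_surjective _ t
    obtain ⟨h, rfl⟩ := Submodule.Quotient.mk_surjective _ s
    rw [LinearMap.coprod_apply, mulX_mk, mulY_mk, P.mem_jacobson]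
    simp [P.aug_x, P.aug_y]

theorem coe_mulXY (g h : Γ) :
    (P.mulXY (Submodule.Quotient.mk g, Submodule.Quotient.mk h) : Γ) = g * P.x + h * P.y := rfl

/-- The inclusion of `Γ / 𝔯` in `N ⊕ M`, onto the relation `y x = q x y`. -/
def inclNM : TopQuot Γ →ₗ[Γ] P.ModN × P.ModM :=
  P.inclN.prod (-(P.inclM ∘ₗ P.scalar q))

theorem shortExact_relation : ShortExactPair P.inclNM P.mulXY := by
  refine ⟨?_, fun t => ?_, fun j => ?_⟩
  · intro s t h
    exact P.shortExact_N.injective (congrArg Prod.fst h)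
  · obtain ⟨t, s⟩ := t
    obtain ⟨g, rfl⟩ := Submodule.Quotient.mk_surjective _ t
    obtain ⟨h, rfl⟩ := Submodule.Quotient.mk_surjective _ s
    constructor
    · intro H
      obtain ⟨a, b, c, d, rfl⟩ := P.exists_elem g
      obtain ⟨a', b', c', d', rfl⟩ := P.exists_elem h
      have H := congrArg Subtype.val H
      rw [coe_mulXY, P.elem_mul_x, P.elem_mul_y, P.elem_add] at H
      obtain ⟨-, h₁, h₂, h₃⟩ := P.elem_eq_zero.mp H
      simp only [add_zero, zero_add] at h₁ h₂
      subst h₁ h₂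
      refine ⟨Submodule.Quotient.mk (P.ι c), Prod.ext ?_ ?_⟩
      · change P.inclN _ = _
        rw [inclN, mulRightQuot_mk, Submodule.Quotient.eq', P.mem_span_x, P.ι_eq_elem,
          P.elem_mul_y]
        refine ⟨b, d, ?_⟩
        rw [neg_add_eq_iff_eq_add, P.elem_add]
        simp
      · change -(P.inclM (P.scalar q (Submodule.Quotient.mk (P.ι c)))) =
          Submodule.Quotient.mk (P.elem 0 b' c' d')
        rw [scalar, mulRightQuot_mk, inclM, mulRightQuot_mk, ← Submodule.Quotient.mk_neg,
          Submodule.Quotient.eq', P.mem_span_y, P.ι_eq_elem c, P.elem_mul_ι, P.elem_mul_x, neg_neg,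
          P.elem_add, eq_neg_of_add_eq_zero_right h₃]
        refine ⟨c', d', ?_⟩
        simp
    · rintro ⟨t, ht⟩
      rw [← ht]
      obtain ⟨g, rfl⟩ := Submodule.Quotient.mk_surjective _ t
      obtain ⟨a, b, c, d, rfl⟩ := P.exists_elem g
      refine Subtype.ext ?_
      change P.elem a b c d * P.y * P.x + (-(P.elem a b c d * P.ι q * P.x)) * P.y = 0
      rw [neg_mul, P.elem_mul_ι, P.elem_mul_x, P.elem_mul_y, P.elem_mul_y, P.elem_mul_x]
      simp
  · obtain ⟨j, hj⟩ := j
    obtain ⟨b, c, d, rfl⟩ := P.mem_jacobson_iff_exists.mp hj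
    refine ⟨(Submodule.Quotient.mk (P.elem b 0 0 0), Submodule.Quotient.mk (P.elem c d 0 0)),
      Subtype.ext ?_⟩
    rw [coe_mulXY, P.elem_mul_x, P.elem_mul_y, P.elem_add]
    simp

/-- The class in `Ext¹(Γ / 𝔯, Γ / 𝔯)` dual to `x`. -/
def extX : Ext (radicalQuotient Γ) (radicalQuotient Γ) 1 := P.shortExact_M.extClass

/-- The class in `Ext¹(Γ / 𝔯, Γ / 𝔯)` dual to `y`. -/
def extY : Ext (radicalQuotient Γ) (radicalQuotient Γ) 1 := P.shortExact_N.extClass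

/-- A scalar, as an element of `Ext⁰(Γ / 𝔯, Γ / 𝔯)`. -/
def extScalar (r : R) : Ext (radicalQuotient Γ) (radicalQuotient Γ) 0 := extOfLinear (P.scalar r)

theorem extScalar_comp_extX (r : R) :
    (P.extScalar r).comp P.extX (zero_add 1) = P.extX.comp (P.extScalar (σ r)) (add_zero 1) := by
  refine (P.shortExact_M.extClass_naturality P.shortExact_M _
    (mulRightQuot _ _ (P.ι r) fun g hg => ?_) _ (quot_hom_ext ?_) (quot_hom_ext ?_)).symm
  · obtain ⟨c, d, rfl⟩ := P.mem_span_y.mp hg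
    rw [P.elem_mul_ι, zero_mul, zero_mul, P.mem_span_y]
    exact ⟨_, _, rfl⟩
  · change Submodule.Quotient.mk (1 * P.ι (σ r) * P.x) =
      Submodule.Quotient.mk (1 * P.x * P.ι r)
    rw [one_mul, one_mul, P.x_mul_ι]
  · change Submodule.Quotient.mk (1 * P.ι r * 1) = Submodule.Quotient.mk (1 * 1 * P.ι r)
    simp only [one_mul, mul_one]

theorem extScalar_comp_extY (r : R) :
    (P.extScalar r).comp P.extY (zero_add 1) =
      P.extY.comp (P.extScalar (σ.symm r)) (add_zero 1) := by
  refine (P.shortExact_N.extClass_naturality P.shortExact_N _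
    (mulRightQuot _ _ (P.ι r) fun g hg => ?_) _ (quot_hom_ext ?_) (quot_hom_ext ?_)).symm
  · obtain ⟨c, d, rfl⟩ := P.mem_span_x.mp hg
    rw [P.elem_mul_ι, zero_mul, zero_mul, P.mem_span_x]
    exact ⟨_, _, rfl⟩
  · change Submodule.Quotient.mk (1 * P.ι (σ.symm r) * P.y) =
      Submodule.Quotient.mk (1 * P.y * P.ι r)
    rw [one_mul, one_mul, P.y_mul_ι]
  · change Submodule.Quotient.mk (1 * P.ι r * 1) = Submodule.Quotient.mk (1 * 1 * P.ι r)
    simp only [one_mul, mul_one]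

theorem extClass_comp_coeffX :
    (shortExactPair_subtype_mkQ (Ring.jacobson Γ)).extClass.comp (extOfLinear P.coeffX)
      (add_zero 1) = P.extX := by
  refine ((shortExactPair_subtype_mkQ (Ring.jacobson Γ)).extClass_naturality P.shortExact_M
    P.coeffX (Submodule.mkQ _) LinearMap.id (LinearMap.ext ?_) (LinearMap.ext fun g => ?_)).trans
    (Ext.mk₀_id_comp _)
  · rintro ⟨j, hj⟩
    obtain ⟨b, c, d, rfl⟩ := P.mem_jacobson_iff_exists.mp hj
    rw [LinearMap.comp_apply, P.coeffX_mk, inclM, mulRightQuot_mk, LinearMap.comp_apply,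
      Submodule.subtype_apply, Submodule.mkQ_apply, Submodule.Quotient.eq', P.mem_span_y,
      P.ι_eq_elem, P.elem_mul_x]
    refine ⟨c, d, ?_⟩
    rw [neg_add_eq_iff_eq_add, P.elem_add]
    simp
  · change Submodule.Quotient.mk (g * 1) = Submodule.Quotient.mk g
    rw [mul_one]

theorem extClass_comp_coeffY :
    (shortExactPair_subtype_mkQ (Ring.jacobson Γ)).extClass.comp (extOfLinear P.coeffY)
      (add_zero 1) = P.extY := by
  refine ((shortExactPair_subtype_mkQ (Ring.jacobson Γ)).extClass_naturality P.shortExact_N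
    P.coeffY (Submodule.mkQ _) LinearMap.id (LinearMap.ext ?_) (LinearMap.ext fun g => ?_)).trans
    (Ext.mk₀_id_comp _)
  · rintro ⟨j, hj⟩
    obtain ⟨b, c, d, rfl⟩ := P.mem_jacobson_iff_exists.mp hj
    rw [LinearMap.comp_apply, P.coeffY_mk, inclN, mulRightQuot_mk, LinearMap.comp_apply,
      Submodule.subtype_apply, Submodule.mkQ_apply, Submodule.Quotient.eq', P.mem_span_x,
      P.ι_eq_elem, P.elem_mul_y]
    refine ⟨b, d, ?_⟩
    rw [neg_add_eq_iff_eq_add, P.elem_add]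
    simp
  · change Submodule.Quotient.mk (g * 1) = Submodule.Quotient.mk g
    rw [mul_one]

theorem projN_comp_fst : P.projN ∘ₗ LinearMap.fst Γ P.ModN P.ModM = P.coeffX ∘ₗ P.mulXY := by
  refine LinearMap.ext fun t => ?_
  obtain ⟨t, s⟩ := t
  obtain ⟨g, rfl⟩ := Submodule.Quotient.mk_surjective _ t
  obtain ⟨h, rfl⟩ := Submodule.Quotient.mk_surjective _ s
  change Submodule.Quotient.mk (g * 1) =
    Submodule.Quotient.mk (P.ι (P.coord (g * P.x + h * P.y)).2.1)
  rw [mul_one, Submodule.Quotient.eq', P.mem_jacobson]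
  obtain ⟨a, b, c, d, rfl⟩ := P.exists_elem g
  obtain ⟨a', b', c', d', rfl⟩ := P.exists_elem h
  rw [P.elem_mul_x, P.elem_mul_y, P.elem_add, P.coord_elem, map_add, map_neg, P.aug_elem, P.aug_ι]
  simp

theorem projM_comp_snd : P.projM ∘ₗ LinearMap.snd Γ P.ModN P.ModM = P.coeffY ∘ₗ P.mulXY := by
  refine LinearMap.ext fun t => ?_
  obtain ⟨t, s⟩ := t
  obtain ⟨g, rfl⟩ := Submodule.Quotient.mk_surjective _ t
  obtain ⟨h, rfl⟩ := Submodule.Quotient.mk_surjective _ s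
  change Submodule.Quotient.mk (h * 1) =
    Submodule.Quotient.mk (P.ι (P.coord (g * P.x + h * P.y)).2.2.1)
  rw [mul_one, Submodule.Quotient.eq', P.mem_jacobson]
  obtain ⟨a, b, c, d, rfl⟩ := P.exists_elem g
  obtain ⟨a', b', c', d', rfl⟩ := P.exists_elem h
  rw [P.elem_mul_x, P.elem_mul_y, P.elem_add, P.coord_elem, map_add, map_neg, P.aug_elem, P.aug_ι]
  simp

theorem coeffX_comp_extY :
    (extOfLinear P.coeffX).comp P.extY (zero_add 1) = P.shortExact_relation.extClass :=
  (P.shortExact_relation.extClass_naturality P.shortExact_N LinearMap.id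
    (LinearMap.fst Γ P.ModN P.ModM) P.coeffX rfl P.projN_comp_fst).symm.trans
    (Ext.comp_mk₀_id _)

theorem coeffY_comp_extX :
    (extOfLinear P.coeffY).comp P.extX (zero_add 1) =
      P.shortExact_relation.extClass.comp (P.extScalar (-q)) (add_zero 1) := by
  refine (P.shortExact_relation.extClass_naturality P.shortExact_M (P.scalar (-q))
    (LinearMap.snd Γ P.ModN P.ModM) P.coeffY ?_ P.projM_comp_snd).symm
  rw [scalar_neg, inclNM, LinearMap.comp_neg]
  rfl

/-- The commutation relation in the Ext algebra. Both products factor through the class of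
`0 → 𝔯 → Γ → Γ / 𝔯 → 0`, and the remaining factors come from the one extension
`0 → Γ / 𝔯 → N ⊕ M → 𝔯 → 0` by projecting to either summand. -/
theorem extY_comp_extX :
    P.extY.comp P.extX rfl = (P.extX.comp P.extY rfl).comp (P.extScalar (-q)) (add_zero 2) := by
  have h : (shortExactPair_subtype_mkQ (Ring.jacobson Γ)).extClass.comp
      P.shortExact_relation.extClass rfl = P.extX.comp P.extY rfl := by
    rw [← P.coeffX_comp_extY, ← Ext.comp_assoc_of_second_deg_zero, P.extClass_comp_coeffX]
  rw [← h, Ext.comp_assoc_of_third_deg_zero, ← P.coeffY_comp_extX,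
    ← Ext.comp_assoc_of_second_deg_zero, P.extClass_comp_coeffY]

theorem exists_scalar (f : TopQuot Γ →ₗ[Γ] TopQuot Γ) : ∃ r, f = P.scalar r := by
  obtain ⟨g, hg⟩ := Submodule.Quotient.mk_surjective _ (f (Submodule.Quotient.mk 1))
  refine ⟨P.aug g, quot_hom_ext ?_⟩
  rw [← hg, scalar, mulRightQuot_mk, one_mul, Submodule.Quotient.eq', P.mem_jacobson]
  simp [P.aug_ι]

theorem exists_projM_scalar (f : P.ModM →ₗ[Γ] TopQuot Γ) : ∃ r, f = P.scalar r ∘ₗ P.projM := by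
  obtain ⟨g, hg⟩ := Submodule.Quotient.mk_surjective _ (f (Submodule.Quotient.mk 1))
  refine ⟨P.aug g, quot_hom_ext ?_⟩
  rw [← hg, LinearMap.comp_apply, scalar, projM, mulRightQuot_mk, mulRightQuot_mk, one_mul, one_mul,
    Submodule.Quotient.eq', P.mem_jacobson]
  simp [P.aug_ι]

/-- The maps `M → Γ / 𝔯` given by distinct scalars are distinct. -/
theorem scalar_injective {r : R} (h : P.scalar r ∘ₗ P.projM = 0) : r = 0 := by
  have h := LinearMap.congr_fun h (Submodule.Quotient.mk 1)
  rw [LinearMap.comp_apply, scalar, projM, mulRightQuot_mk, mulRightQuot_mk, one_mul, one_mul,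
    LinearMap.zero_apply, Submodule.Quotient.mk_eq_zero, P.mem_jacobson, P.aug_ι] at h
  exact h

/-- The class of the periodic resolution of `M` restricts to the class dual to `y`. -/
theorem extClass_comp_projM :
    P.shortExact_periodic.extClass.comp (extOfLinear P.projM) (add_zero 1) =
      (extOfLinear P.projM).comp P.extY (zero_add 1) := by
  refine P.shortExact_periodic.extClass_naturality P.shortExact_N P.projM (Submodule.mkQ _)
    P.projM (quot_hom_ext ?_) (LinearMap.ext fun g => ?_)
  · change Submodule.Quotient.mk (1 * 1 * P.y) = Submodule.Quotient.mk (1 * P.y)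
    rw [mul_one]
  · rfl

/-- The powers `β ^ n` of the class dual to `y`, multiplied by a scalar. -/
def extYPow : ∀ n : ℕ, R → Ext (radicalQuotient Γ) (radicalQuotient Γ) n
  | 0, r => P.extScalar r
  | n + 1, r => P.extY.comp (extYPow n r) (Nat.add_comm 1 n)

theorem extYPow_zero (n : ℕ) : P.extYPow n 0 = 0 := by
  induction n with
  | zero =>
    have h : P.scalar 0 = 0 := by simpa using P.scalar_add 0 0
    rw [extYPow, extScalar, h, extOfLinear_eq_zero]
  | succ n ih => rw [extYPow, ih, Ext.comp_zero]

/-- Restricting `β ^ n r` to `M`. -/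
def restrictYPow (n : ℕ) (r : R) : Ext (ModuleCat.of Γ P.ModM) (radicalQuotient Γ) n :=
  (extOfLinear P.projM).comp (P.extYPow n r) (zero_add n)

theorem restrictYPow_succ (n : ℕ) (r : R) :
    P.restrictYPow (n + 1) r =
      P.shortExact_periodic.extClass.comp (P.restrictYPow n r) (Nat.add_comm 1 n) := by
  rw [restrictYPow, extYPow, restrictYPow,
    ← Ext.comp_assoc (extOfLinear P.projM) P.extY (P.extYPow n r) (zero_add 1) (Nat.add_comm 1 n)
      (by lia),
    ← P.extClass_comp_projM, Ext.comp_assoc_of_second_deg_zero]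

/-- Dimension shifting along `0 → M → Γ → M → 0` describes all of `Extⁿ(M, Γ / 𝔯)`. -/
theorem exists_restrictYPow (n : ℕ) (e : Ext (ModuleCat.of Γ P.ModM) (radicalQuotient Γ) n) :
    ∃ r, e = P.restrictYPow n r := by
  induction n with
  | zero =>
    obtain ⟨f, rfl⟩ := exists_extOfLinear e
    obtain ⟨r, rfl⟩ := P.exists_projM_scalar f
    exact ⟨r, (extOfLinear_comp _ _).symm⟩
  | succ n ih =>
    have hproj : Projective (ModuleCat.of Γ Γ) := inferInstance
    obtain ⟨e', rfl⟩ := P.shortExact_periodic.exists_of_extOfLinear_comp_eq_zero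
      (Nat.add_comm 1 n) e (Ext.eq_zero_of_projective (P := ModuleCat.of Γ Γ) _)
    obtain ⟨r, rfl⟩ := ih e'
    exact ⟨r, (P.restrictYPow_succ n r).symm⟩

/-- The connecting maps of `0 → M → Γ → M → 0` are injective also in degree zero: a map
`Γ → Γ / 𝔯` vanishes on `Γy`. -/
theorem restrictYPow_eq_zero {n : ℕ} {r : R} (h : P.restrictYPow n r = 0) : r = 0 := by
  induction n with
  | zero =>
    rw [restrictYPow, extYPow, extScalar, extOfLinear_comp, extOfLinear_eq_zero] at h
    exact P.scalar_injective h
  | succ n ih =>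
    rw [restrictYPow_succ] at h
    obtain ⟨e, he⟩ := P.shortExact_periodic.exists_of_extClass_comp_eq_zero _ _ h
    refine ih (he.symm.trans ?_)
    cases n with
    | zero =>
      obtain ⟨f, rfl⟩ := exists_extOfLinear e
      rw [extOfLinear_comp, extOfLinear_eq_zero]
      refine quot_hom_ext ?_
      obtain ⟨g, hg⟩ := Submodule.Quotient.mk_surjective _ (f 1)
      change f (1 * P.y) = 0
      rw [one_mul, ← mul_one P.y, ← smul_eq_mul, map_smul, ← hg, ← Submodule.Quotient.mk_smul,
        Submodule.Quotient.mk_eq_zero, P.mem_jacobson, smul_eq_mul, map_mul, P.aug_y, zero_mul]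
    | succ n =>
      rw [Ext.eq_zero_of_projective (P := ModuleCat.of Γ Γ) e, Ext.comp_zero]

/-- Left multiples of `α` vanish on `M`, since `α` is the class of `0 → Γ / 𝔯 → M → Γ / 𝔯 → 0`. -/
theorem restrict_extX_comp {n n' : ℕ} (hn : 1 + n = n')
    (g : Ext (radicalQuotient Γ) (radicalQuotient Γ) n) :
    (extOfLinear P.projM).comp (P.extX.comp g hn) (zero_add n') = 0 := by
  rw [← Ext.comp_assoc _ _ _ (zero_add 1) hn (by lia)]
  have : (extOfLinear P.projM).comp P.extX (zero_add 1) = 0 :=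
    P.shortExact_M.extOfLinear_comp_extClass
  rw [this, Ext.zero_comp]

/-- Every class of positive degree is `α g + β ^ n r`. -/
theorem exists_extX_comp_add (n : ℕ) (e : Ext (radicalQuotient Γ) (radicalQuotient Γ) (n + 1)) :
    ∃ g r, e = P.extX.comp g (Nat.add_comm 1 n) + P.extYPow (n + 1) r := by
  obtain ⟨r, hr⟩ := P.exists_restrictYPow (n + 1)
    ((extOfLinear P.projM).comp e (zero_add (n + 1)))
  obtain ⟨g, hg⟩ := P.shortExact_M.exists_of_extOfLinear_comp_eq_zero (Nat.add_comm 1 n)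
    (e - P.extYPow (n + 1) r) (by
      rw [sub_eq_add_neg, Ext.comp_add, Ext.comp_neg, hr, restrictYPow, add_neg_cancel])
  exact ⟨g, r, (sub_eq_iff_eq_add.mp hg.symm)⟩

/-- The decomposition `α g + β ^ n r` is unique. -/
theorem extX_comp_add_eq_zero {n : ℕ} {g : Ext (radicalQuotient Γ) (radicalQuotient Γ) n} {r : R}
    (h : P.extX.comp g (Nat.add_comm 1 n) + P.extYPow (n + 1) r = 0) : g = 0 ∧ r = 0 := by
  have hr : r = 0 := by
    apply P.restrictYPow_eq_zero (n := n + 1)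
    have := congrArg (fun e => (extOfLinear P.projM).comp e (zero_add (n + 1))) h
    simpa only [Ext.comp_add, P.restrict_extX_comp, zero_add, Ext.comp_zero,
      restrictYPow] using this
  refine ⟨?_, hr⟩
  rw [hr, extYPow_zero, add_zero] at h
  -- The map induced by `Γ / 𝔯 → M` vanishes, as all of `Ext(M, Γ / 𝔯)` comes from `Γ / 𝔯`.
  obtain ⟨e, rfl⟩ := P.shortExact_M.exists_of_extClass_comp_eq_zero _ _ h
  obtain ⟨s, rfl⟩ := P.exists_restrictYPow n e
  have h0 : P.projM ∘ₗ P.inclM = 0 := P.shortExact_M.exact.linearMap_comp_eq_zero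
  rw [restrictYPow, ← Ext.comp_assoc_of_second_deg_zero, extOfLinear_comp, h0,
    extOfLinear_eq_zero.mpr rfl, Ext.zero_comp]

end QuantumExterior

/-! ### Graded rings and their graded centre -/

section

open Finset

section GradedCentre

variable (A : ℕ → Type*) [∀ n, AddCommGroup (A n)]

/-- The homogeneous elements of degree `n`, as a subgroup. -/
def homog (n : ℕ) : AddSubgroup (⨁ n, A n) := (DirectSum.of A n).range

/-- The elements whose components all have degree at most `D`. -/
def degreeLE (D : ℕ) : AddSubgroup (⨁ n, A n) :=
  AddSubgroup.closure {z | ∃ n ≤ D, z ∈ homog A n}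

variable {A}

theorem of_mem_homog {n : ℕ} (g : A n) : DirectSum.of A n g ∈ homog A n := ⟨g, rfl⟩

theorem degreeLE_mono {D D' : ℕ} (h : D ≤ D') : degreeLE A D ≤ degreeLE A D' :=
  AddSubgroup.closure_mono fun _ ⟨n, hn, hz⟩ => ⟨n, hn.trans h, hz⟩

theorem exists_mem_degreeLE (z : ⨁ n, A n) : ∃ D, z ∈ degreeLE A D := by
  induction z using DirectSum.induction_on with
  | zero => exact ⟨0, zero_mem _⟩
  | of n g => exact ⟨n, AddSubgroup.subset_closure ⟨n, le_rfl, g, rfl⟩⟩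
  | add z w hz hw =>
    obtain ⟨D, hD⟩ := hz
    obtain ⟨D', hD'⟩ := hw
    exact ⟨max D D', add_mem (degreeLE_mono (le_max_left _ _) hD)
      (degreeLE_mono (le_max_right _ _) hD')⟩

theorem exists_subset_degreeLE (S : Finset (⨁ n, A n)) : ∃ D, ∀ z ∈ S, z ∈ degreeLE A D := by
  choose f hf using exists_mem_degreeLE (A := A)
  exact ⟨S.sup f, fun z hz => degreeLE_mono (le_sup hz) (hf z)⟩

theorem eq_zero_of_mem_degreeLE {D n : ℕ} (hn : D < n) {z : ⨁ n, A n} (hz : z ∈ homog A n)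
    (h : z ∈ degreeLE A D) : z = 0 := by
  obtain ⟨g, rfl⟩ := hz
  have key : ∀ w ∈ degreeLE A D, w n = 0 := by
    intro w hw
    induction hw using AddSubgroup.closure_induction with
    | mem w hw =>
      obtain ⟨k, hk, x, rfl⟩ := hw
      exact DirectSum.of_eq_of_ne _ _ _ (by lia)
    | zero => rfl
    | add w w' _ _ h h' => rw [DirectSum.add_apply, h, h', add_zero]
    | neg w _ h => rw [DFinsupp.neg_apply, h, neg_zero]
  have := key _ h
  rw [DirectSum.of_eq_same] at this
  rw [this, map_zero]

variable (A) [DirectSum.GRing A]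

/-- The graded centre of a graded ring: the subring generated by the homogeneous elements which
commute with all homogeneous elements up to the Koszul sign. -/
def gradedCentreOf : Subring (⨁ n, A n) :=
  Subring.closure {z | ∃ (n : ℕ) (x : A n), z = DirectSum.of A n x ∧
    ∀ (k : ℕ) (g : A k), z * DirectSum.of A k g = (-1) ^ (k * n) * (DirectSum.of A k g * z)}

variable {A}

theorem mul_mem_homog {i j : ℕ} {z w : ⨁ n, A n} (hz : z ∈ homog A i) (hw : w ∈ homog A j) :
    z * w ∈ homog A (i + j) := by
  obtain ⟨g, rfl⟩ := hz
  obtain ⟨h, rfl⟩ := hw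
  rw [DirectSum.of_mul_of]
  exact of_mem_homog _

theorem one_mem_homog : (1 : ⨁ n, A n) ∈ homog A 0 := of_mem_homog (A := A) GradedMonoid.GOne.one

theorem pow_mem_homog {z : ⨁ n, A n} (hz : z ∈ homog A 1) (s : ℕ) : z ^ s ∈ homog A s := by
  induction s with
  | zero => exact one_mem_homog
  | succ s ih =>
    rw [pow_succ]
    exact mul_mem_homog ih hz

theorem homog_mul_mem_degreeLE {D : ℕ} {z w : ⨁ n, A n} (hz : z ∈ homog A 0)
    (hw : w ∈ degreeLE A D) : z * w ∈ degreeLE A D := by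
  induction hw using AddSubgroup.closure_induction with
  | mem w hw =>
    obtain ⟨n, hn, hw⟩ := hw
    refine AddSubgroup.subset_closure ⟨n, hn, ?_⟩
    simpa using mul_mem_homog hz hw
  | zero => simp
  | add w w' _ _ h h' =>
    rw [mul_add]
    exact add_mem h h'
  | neg w _ h =>
    rw [mul_neg]
    exact neg_mem h

/-- If there are no graded central elements in positive degree, a graded ring which is finite over
its graded centre is bounded. -/
theorem exists_bound_of_finite [Module.Finite (gradedCentreOf A) (⨁ n, A n)]
    (h : ∀ n, 0 < n → ∀ z ∈ homog A n,
      (∀ (k : ℕ) (g : A k), z * DirectSum.of A k g = (-1) ^ (k * n) * (DirectSum.of A k g * z)) →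
      z = 0) : ∃ D, ∀ n, D < n → ∀ z ∈ homog A n, z = 0 := by
  have hZ : ∀ z ∈ gradedCentreOf A, z ∈ homog A 0 := by
    have : gradedCentreOf A ≤ (DirectSum.ofZeroRingHom A).range := by
      refine Subring.closure_le.mpr ?_
      rintro _ ⟨n, x, rfl, hx⟩
      rcases Nat.eq_zero_or_pos n with rfl | hn
      · exact ⟨x, rfl⟩
      · rw [h n hn _ (of_mem_homog x) hx]
        exact zero_mem _
    intro z hz
    obtain ⟨g, rfl⟩ := this hz
    exact of_mem_homog g
  obtain ⟨S, hS⟩ := Module.Finite.fg_top (R := gradedCentreOf A) (M := ⨁ n, A n)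
  obtain ⟨D, hD⟩ := exists_subset_degreeLE S
  refine ⟨D, fun n hn z hz => eq_zero_of_mem_degreeLE hn hz ?_⟩
  have hz' : z ∈ Submodule.span (gradedCentreOf A) (S : Set (⨁ n, A n)) := hS ▸ Submodule.mem_top
  clear hz
  induction hz' using Submodule.span_induction with
  | mem w hw => exact hD w hw
  | zero => exact zero_mem _
  | add w w' _ _ h h' => exact add_mem h h'
  | smul c w _ h => exact homog_mul_mem_degreeLE (hZ c c.2) h

end GradedCentre

section Shift

variable {K : Type*} [Field K] {m : ℕ}

/-- The automorphism of `K ^ (ℤ / m)` that shifts the indices. -/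
def shift (K : Type*) [Field K] (m : ℕ) : (ZMod m → K) ≃+* (ZMod m → K) where
  toFun r i := r (i + 1)
  invFun r i := r (i - 1)
  left_inv r := by simp
  right_inv r := by simp
  map_mul' _ _ := rfl
  map_add' _ _ := rfl

theorem shift_apply (r : ZMod m → K) (i : ZMod m) : shift K m r i = r (i + 1) := rfl

theorem shift_symm_apply (r : ZMod m → K) (i : ZMod m) : (shift K m).symm r i = r (i - 1) := rfl

/-- The product of `t` consecutive values of `c`, in steps of `d`. -/
def stepProd (c : ZMod m → K) (d : ZMod m) (t : ℕ) : ZMod m → K :=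
  fun i => ∏ j ∈ range t, c (i + j * d)

theorem stepProd_zero (c : ZMod m → K) (d : ZMod m) : stepProd c d 0 = 1 := rfl

theorem stepProd_succ (c : ZMod m → K) (d : ZMod m) (t : ℕ) :
    stepProd c d (t + 1) = c * fun i => stepProd c d t (i + d) := by
  funext i
  simp only [stepProd, Pi.mul_apply]
  rw [prod_range_succ', mul_comm]
  congr 1
  · simp
  · refine prod_congr rfl fun j _ => ?_
    congr 1
    push_cast
    ring

variable [NeZero m]

theorem prod_stepProd (c : ZMod m → K) (d : ZMod m) (t : ℕ) :
    ∏ i, stepProd c d t i = (∏ i, c i) ^ t := by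
  simp only [stepProd]
  rw [prod_comm]
  have : ∀ j : ℕ, ∏ i, c (i + j * d) = ∏ i, c i := fun j =>
    Fintype.prod_equiv (Equiv.addRight ((j : ZMod m) * d)) _ _ fun _ => rfl
  simp [this]

/-- A full turn around the cycle collects every value once, in either direction. -/
theorem stepProd_full (c : ZMod m → K) (d : ZMod m) (hd : d * d = 1) :
    stepProd c d m = fun _ => ∏ i, c i := by
  funext i
  refine prod_nbij' (fun j => i + j * d) (fun k => ((k - i) * d).val) ?_ ?_ ?_ ?_ ?_
  · simp
  · intro k _
    exact mem_range.mpr (ZMod.val_lt _)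
  · intro j hj
    have : (i + (j : ZMod m) * d - i) * d = j := by
      rw [add_sub_cancel_left, mul_assoc, hd, mul_one]
    simp only [this]
    exact ZMod.val_cast_of_lt (mem_range.mp hj)
  · intro k _
    simp only [ZMod.natCast_val, ZMod.cast_id', id_eq]
    rw [mul_assoc, hd]
    ring
  · intro j _
    rfl

/-- A solution of a first order linear recursion around the cycle vanishes, unless the
product of the coefficients is trivial. -/
theorem eq_zero_of_recursion {e : K} (he : e * e = 1) {u r : ZMod m → K} (hu : ∀ i, u i ≠ 0)
    (hp : (∏ i, u i) ^ 2 ≠ 1) (h : ∀ i, e * r i = u i * r (i + 1)) : r = 0 := by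
  by_contra hr
  have hne : ∀ i, r i ≠ 0 := by
    intro i hi
    apply hr
    have key : ∀ j : ℕ, r (i + j) = 0 := by
      intro j
      induction j with
      | zero => simpa using hi
      | succ j ih =>
        have := h (i + j)
        rw [ih, mul_zero, eq_comm, mul_eq_zero, or_iff_right (hu _)] at this
        rw [← this]
        push_cast
        ring_nf
    funext k
    have := key (k - i).val
    rwa [ZMod.natCast_val, ZMod.cast_id', id_eq, add_sub_cancel] at this
  have hprod : e ^ m * ∏ i, r i = (∏ i, u i) * ∏ i, r i := by
    have h1 : ∏ i, (e * r i) = ∏ i, (u i * r (i + 1)) := prod_congr rfl fun i _ => h i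
    rw [prod_mul_distrib, prod_mul_distrib, prod_const, card_univ, ZMod.card] at h1
    rwa [Fintype.prod_equiv (Equiv.addRight (1 : ZMod m)) (fun i => r (i + 1)) r fun _ => rfl] at h1
  have := mul_right_cancel₀ (prod_ne_zero_iff.mpr fun i _ => hne i) hprod
  apply hp
  rw [← this, ← pow_mul, mul_comm, pow_mul, pow_two, he, one_pow]

end Shift

end

/-! ### Quantum planes -/

section

open Finset

/-- A presentation of a graded ring as a quantum plane on variables `a`, `b` of degree one over
`R = K ^ (ℤ / m)`, twisted by the shift and with commutation parameter `c`. The last two fields say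
that the monomials `a ^ s b ^ t` form a basis over `R`, by peeling off one factor `a` at a time. -/
structure QuantumPlane (K : Type*) [Field K] (m : ℕ) (c : ZMod m → K) (A : ℕ → Type*)
    [∀ n, AddCommGroup (A n)] [DirectSum.GRing A] where
  ε : (ZMod m → K) →+* ⨁ n, A n
  a : ⨁ n, A n
  b : ⨁ n, A n
  ε_mem r : ε r ∈ homog A 0
  a_mem : a ∈ homog A 1
  b_mem : b ∈ homog A 1
  exists_ε : ∀ z ∈ homog A 0, ∃ r, z = ε r
  ε_inj r : ε r = 0 → r = 0
  ε_mul_a r : ε r * a = a * ε (shift K m r)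
  ε_mul_b r : ε r * b = b * ε ((shift K m).symm r)
  b_mul_a : b * a = a * b * ε c
  exists_add : ∀ n, ∀ z ∈ homog A (n + 1), ∃ w ∈ homog A n, ∃ r, z = a * w + b ^ (n + 1) * ε r
  eq_zero : ∀ n, ∀ w ∈ homog A n, ∀ r, a * w + b ^ (n + 1) * ε r = 0 → w = 0 ∧ r = 0

namespace QuantumPlane

variable {K : Type*} [Field K] {m : ℕ} {c : ZMod m → K} {A : ℕ → Type*}
  [∀ n, AddCommGroup (A n)] [DirectSum.GRing A] (Q : QuantumPlane K m c A)

theorem monomial_mem (s t : ℕ) (r : ZMod m → K) :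
    Q.a ^ s * Q.b ^ t * Q.ε r ∈ homog A (s + t) := by
  simpa using mul_mem_homog (mul_mem_homog (pow_mem_homog Q.a_mem s) (pow_mem_homog Q.b_mem t))
    (Q.ε_mem r)

/-- The polynomial `∑ a ^ s b ^ (n - s) r s`, homogeneous of degree `n`. -/
def poly (n : ℕ) (r : ℕ → ZMod m → K) : ⨁ n, A n :=
  ∑ s ∈ range (n + 1), Q.a ^ s * Q.b ^ (n - s) * Q.ε (r s)

theorem poly_mem (n : ℕ) (r : ℕ → ZMod m → K) : Q.poly n r ∈ homog A n := by
  refine sum_mem fun s hs => ?_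
  have := Q.monomial_mem s (n - s) (r s)
  rwa [Nat.add_sub_cancel' (Nat.lt_succ_iff.mp (mem_range.mp hs))] at this

theorem poly_succ (n : ℕ) (r : ℕ → ZMod m → K) :
    Q.poly (n + 1) r = Q.a * Q.poly n (fun s => r (s + 1)) + Q.b ^ (n + 1) * Q.ε (r 0) := by
  rw [poly, sum_range_succ', poly, mul_sum]
  congr 1
  · refine sum_congr rfl fun s _ => ?_
    rw [pow_succ', Nat.add_sub_add_right]
    simp only [mul_assoc]
  · simp

/-- The monomials `a ^ s b ^ t` span over `R`. -/
theorem exists_poly (n : ℕ) {z : ⨁ n, A n} (hz : z ∈ homog A n) : ∃ r, z = Q.poly n r := by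
  induction n generalizing z with
  | zero =>
    obtain ⟨r, rfl⟩ := Q.exists_ε z hz
    exact ⟨fun _ => r, by simp [poly]⟩
  | succ n ih =>
    obtain ⟨w, hw, r, rfl⟩ := Q.exists_add n z hz
    obtain ⟨r', rfl⟩ := ih hw
    refine ⟨fun | 0 => r | s + 1 => r' s, ?_⟩
    rw [poly_succ]

/-- The monomials `a ^ s b ^ t` are independent over `R`. -/
theorem poly_eq_zero {n : ℕ} {r : ℕ → ZMod m → K} (h : Q.poly n r = 0) :
    ∀ s ≤ n, r s = 0 := by
  induction n generalizing r with
  | zero =>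
    intro s hs
    obtain rfl : s = 0 := by lia
    exact Q.ε_inj _ (by simpa [poly] using h)
  | succ n ih =>
    rw [poly_succ] at h
    obtain ⟨h1, h2⟩ := Q.eq_zero n _ (Q.poly_mem n _) _ h
    intro s hs
    cases s with
    | zero => exact h2
    | succ s => exact ih h1 s (by lia)

theorem eq_zero_of_a_pow_mul {n : ℕ} (s : ℕ) {z : ⨁ n, A n} (hz : z ∈ homog A n)
    (h : Q.a ^ s * z = 0) : z = 0 := by
  induction s with
  | zero => simpa using h
  | succ s ih =>
    rw [pow_succ', mul_assoc] at h
    exact ih (Q.eq_zero _ _ (mul_mem_homog (pow_mem_homog Q.a_mem s) hz) 0 (by simpa using h)).1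

theorem a_pow_ne_zero (s : ℕ) : Q.a ^ s ≠ 0 := by
  intro h
  have h1 : (1 : ⨁ n, A n) = 0 := Q.eq_zero_of_a_pow_mul s one_mem_homog (by rw [h, zero_mul])
  have h2 : (1 : ZMod m → K) = 0 := Q.ε_inj 1 (by rw [map_one, h1])
  exact one_ne_zero (congrFun h2 0)

theorem b_mul_a_pow (s : ℕ) : Q.b * Q.a ^ s = Q.a ^ s * Q.b * Q.ε (stepProd c 1 s) := by
  induction s with
  | zero => simp [stepProd_zero]
  | succ s ih =>
    rw [pow_succ, ← mul_assoc, ih, mul_assoc, Q.ε_mul_a, ← mul_assoc, mul_assoc _ Q.b, Q.b_mul_a,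
      stepProd_succ, map_mul]
    simp only [mul_assoc]
    rfl

theorem b_pow_mul_a (t : ℕ) : Q.b ^ t * Q.a = Q.a * Q.b ^ t * Q.ε (stepProd c (-1) t) := by
  induction t with
  | zero => simp [stepProd_zero]
  | succ t ih =>
    have h : (fun i => stepProd c (-1) t (i + -1)) = (shift K m).symm (stepProd c (-1) t) := by
      funext i
      rw [shift_symm_apply, sub_eq_add_neg]
    rw [pow_succ, mul_assoc, Q.b_mul_a, ← mul_assoc, ← mul_assoc, ih, mul_assoc _ _ Q.b, Q.ε_mul_b,
      stepProd_succ, mul_comm c, map_mul, h]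
    simp only [mul_assoc]

/-- Comparing coefficients in `z a = ± a z`. -/
theorem recursion_of_commute_a {n : ℕ} {r : ℕ → ZMod m → K} {e : K}
    (h : Q.poly n r * Q.a = Q.a * Q.poly n r * Q.ε (fun _ => e)) {s : ℕ} (hs : s ≤ n)
    (i : ZMod m) : e * r s i = stepProd c (-1) (n - s) i * r s (i + 1) := by
  have h1 : Q.poly n r * Q.a =
      Q.a * Q.poly n (fun s => stepProd c (-1) (n - s) * shift K m (r s)) := by
    rw [poly, poly, sum_mul, mul_sum]
    refine sum_congr rfl fun s _ => ?_
    rw [mul_assoc, Q.ε_mul_a, ← mul_assoc, mul_assoc _ _ Q.a, Q.b_pow_mul_a, map_mul,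
      ← mul_assoc (Q.a ^ s), ← mul_assoc (Q.a ^ s), ← pow_succ, pow_succ']
    simp only [mul_assoc]
  have h2 : Q.a * Q.poly n r * Q.ε (fun _ => e) = Q.a * Q.poly n (fun s => r s * fun _ => e) := by
    rw [mul_assoc, poly, poly, sum_mul]
    congr 1
    refine sum_congr rfl fun s _ => ?_
    rw [map_mul, mul_assoc _ (Q.ε _)]
  have h3 : Q.a ^ 1 * Q.poly n (fun s => stepProd c (-1) (n - s) * shift K m (r s) -
      r s * fun _ => e) = 0 := by
    rw [h1, h2, ← sub_eq_zero, ← mul_sub, poly, poly, ← sum_sub_distrib] at h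
    rw [pow_one, poly]
    simpa only [map_sub, mul_sub] using h
  have h4 := Q.poly_eq_zero (Q.eq_zero_of_a_pow_mul 1 (Q.poly_mem n _) h3) s hs
  have h5 := congrFun h4 i
  simp only [Pi.sub_apply, Pi.mul_apply, shift_apply, Pi.zero_apply] at h5
  rw [mul_comm e, ← sub_eq_zero.mp h5]

/-- Comparing coefficients in `z b = ± b z`, for `z = a ^ n r`. -/
theorem recursion_of_commute_b {n : ℕ} {r : ZMod m → K} {e : K}
    (h : Q.a ^ n * Q.ε r * Q.b = Q.b * (Q.a ^ n * Q.ε r) * Q.ε (fun _ => e)) (i : ZMod m) :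
    r (i - 1) = stepProd c 1 n i * r i * e := by
  rw [mul_assoc, Q.ε_mul_b, ← mul_assoc Q.b, Q.b_mul_a_pow, mul_assoc (_ * _) (Q.ε _), ← map_mul,
    mul_assoc _ (Q.ε _), ← map_mul, mul_assoc, ← sub_eq_zero, ← mul_sub, ← mul_sub, ← map_sub] at h
  have h1 := Q.eq_zero_of_a_pow_mul n (mul_mem_homog Q.b_mem (Q.ε_mem _)) h
  have h2 := (Q.eq_zero 0 0 (zero_mem _) _ 
    (by rw [mul_zero, zero_add, zero_add, pow_one]; exact h1)).2
  have h3 := congrFun h2 i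
  exact (sub_eq_zero.mp h3).trans (mul_assoc _ _ _).symm

variable [NeZero m]

/-- Unless `∏ c` is a root of unity, no graded central element has positive degree. -/
theorem eq_zero_of_graded_central (Q : QuantumPlane K m c A) (hc : ∀ i, c i ≠ 0)
    (hp : ∀ t, 0 < t → (∏ i, c i) ^ t ≠ 1)
    {n : ℕ} (hn : 0 < n) {z : ⨁ n, A n} (hz : z ∈ homog A n)
    (h : ∀ (k : ℕ) (g : A k), z * DirectSum.of A k g = (-1) ^ (k * n) * (DirectSum.of A k g * z)) :
    z = 0 := by
  have hsign : ∀ w ∈ homog A 1, z * w = w * z * Q.ε (fun _ => (-1 : K) ^ n) := by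
    rintro _ ⟨g, rfl⟩
    have he : Q.ε (fun _ => (-1 : K) ^ n) = (-1) ^ n := by
      rw [← map_one Q.ε, ← map_neg, ← map_pow]
      rfl
    rw [h, one_mul, he]
    exact ((Commute.neg_one_left _).pow_left n).eq
  have he : ((-1 : K) ^ n) * (-1) ^ n = 1 := by rw [← mul_pow]; simp
  have hstep : ∀ (d : ZMod m) (t : ℕ) (i : ZMod m), stepProd c d t i ≠ 0 := fun d t i =>
    prod_ne_zero_iff.mpr fun _ _ => hc _
  have hpow : ∀ (d : ZMod m) (t : ℕ), 0 < t → (∏ i, stepProd c d t i) ^ 2 ≠ 1 := by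
    intro d t ht
    rw [prod_stepProd, ← pow_mul]
    exact hp _ (by lia)
  obtain ⟨r, rfl⟩ := Q.exists_poly n hz
  -- Commuting with `a` leaves only the coefficient of `a ^ n`, and commuting with `b` kills it.
  have hlow : ∀ s < n, r s = 0 := fun s hs =>
    eq_zero_of_recursion he (hstep _ _) (hpow (-1) (n - s) (by lia))
      (Q.recursion_of_commute_a (hsign _ Q.a_mem) hs.le)
  have htop : Q.poly n r = Q.a ^ n * Q.ε (r n) := by
    rw [poly, sum_range_succ, sum_eq_zero, zero_add, Nat.sub_self, pow_zero, mul_one]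
    intro s hs
    rw [hlow s (mem_range.mp hs), map_zero, mul_zero]
  have hb := hsign _ Q.b_mem
  rw [htop] at hb ⊢
  have hrec := Q.recursion_of_commute_b hb
  have hprod : ∏ i, stepProd c 1 n (i + 1) = ∏ i, stepProd c 1 n i :=
    Fintype.prod_equiv (Equiv.addRight (1 : ZMod m)) _ _ fun _ => rfl
  have : r n = 0 := by
    refine eq_zero_of_recursion (u := fun i => stepProd c 1 n (i + 1)) he (fun i => hstep _ _ _)
      (by rw [hprod]; exact hpow _ _ hn) fun i => ?_
    have := hrec (i + 1)
    rw [add_sub_cancel_right] at this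
    rw [this, mul_comm, mul_assoc, he, mul_one]
  rw [this, map_zero, mul_zero]

theorem exists_pow_eq_one_of_finite (Q : QuantumPlane K m c A) (hc : ∀ i, c i ≠ 0)
    [Module.Finite (gradedCentreOf A) (⨁ n, A n)] : ∃ d, 0 < d ∧ (∏ i, c i) ^ d = 1 := by
  by_contra! hp
  obtain ⟨D, hD⟩ := exists_bound_of_finite (A := A) fun n hn z hz h =>
    Q.eq_zero_of_graded_central hc hp hn hz h
  exact Q.a_pow_ne_zero (D + 1) (hD (D + 1) (by lia) _ (pow_mem_homog Q.a_mem _))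

end QuantumPlane

end

/-! ### Finiteness over the graded centre -/

section

open Finset

theorem mem_gradedCentreOf {A : ℕ → Type*} [∀ n, AddCommGroup (A n)] [DirectSum.GRing A]
    {z : ⨁ n, A n} {n : ℕ} (hn : Even n) (hz : z ∈ homog A n) (h : ∀ w, Commute z w) :
    z ∈ gradedCentreOf A := by
  obtain ⟨x, rfl⟩ := hz
  refine Subring.subset_closure ⟨n, x, rfl, fun k g => ?_⟩
  rw [(hn.mul_left k).neg_one_pow, one_mul]
  exact h _

theorem stepProd_full_mul {K : Type*} [Field K] {m : ℕ} [NeZero m] (c : ZMod m → K) (d : ZMod m)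
    (hd : d * d = 1) (k : ℕ) : stepProd c d (m * k) = fun _ => (∏ i, c i) ^ k := by
  induction k with
  | zero =>
    funext i
    simp [stepProd]
  | succ k ih =>
    funext i
    have h1 := congrFun ih i
    have h2 := congrFun (stepProd_full c d hd) i
    simp only [stepProd] at h1 h2 ⊢
    rw [Nat.mul_succ, prod_range_add, h1, pow_succ, ← h2]
    simp

namespace QuantumPlane

variable {K : Type*} [Field K] {m : ℕ} {c : ZMod m → K} {A : ℕ → Type*}
  [∀ n, AddCommGroup (A n)] [DirectSum.GRing A] (Q : QuantumPlane K m c A)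

theorem ε_mul_a_pow (r : ZMod m → K) (s : ℕ) :
    Q.ε r * Q.a ^ s = Q.a ^ s * Q.ε (fun i => r (i + s)) := by
  induction s with
  | zero => simp
  | succ s ih =>
    rw [pow_succ, ← mul_assoc, ih, mul_assoc, Q.ε_mul_a, ← mul_assoc]
    congr 2
    funext i
    rw [shift_apply]
    push_cast
    ring_nf

theorem ε_mul_b_pow (r : ZMod m → K) (s : ℕ) :
    Q.ε r * Q.b ^ s = Q.b ^ s * Q.ε (fun i => r (i - s)) := by
  induction s with
  | zero => simp
  | succ s ih =>
    rw [pow_succ, ← mul_assoc, ih, mul_assoc, Q.ε_mul_b, ← mul_assoc]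
    congr 2
    funext i
    rw [shift_symm_apply]
    push_cast
    ring_nf

/-- The variables and the scalars generate. -/
theorem commute_all {z : ⨁ n, A n} (ha : Commute z Q.a) (hb : Commute z Q.b)
    (hε : ∀ r, Commute z (Q.ε r)) (w : ⨁ n, A n) : Commute z w := by
  induction w using DirectSum.induction_on with
  | zero => exact Commute.zero_right z
  | of n g =>
    obtain ⟨r, hr⟩ := Q.exists_poly n (of_mem_homog g)
    rw [hr, poly]
    exact Commute.sum_right _ _ _ fun s _ =>
      ((ha.pow_right s).mul_right (hb.pow_right _)).mul_right (hε _)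
  | add w w' h h' => exact h.add_right h'

theorem commute_ε_const (x : K) (w : ⨁ n, A n) : Commute (Q.ε (fun _ => x)) w :=
  Q.commute_all (z := Q.ε (fun _ => x)) (Q.ε_mul_a (fun _ => x)) (Q.ε_mul_b (fun _ => x))
    (fun r => by rw [Commute, SemiconjBy, ← map_mul, mul_comm, map_mul]) w

variable [NeZero m]

theorem commute_a_pow {k : ℕ} (hc : (∏ i, c i) ^ k = 1) (w : ⨁ n, A n) :
    Commute (Q.a ^ (m * k)) w := by
  refine Q.commute_all ((Commute.refl _).pow_left _) ?_ (fun r => ?_) w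
  · have h : (fun _ => 1 : ZMod m → K) = 1 := rfl
    refine Eq.symm ((Q.b_mul_a_pow _).trans ?_)
    rw [stepProd_full_mul c 1 (one_mul 1), hc, h, map_one, mul_one]
  · refine Eq.symm ((Q.ε_mul_a_pow r _).trans ?_)
    simp

theorem commute_b_pow {k : ℕ} (hc : (∏ i, c i) ^ k = 1) (w : ⨁ n, A n) :
    Commute (Q.b ^ (m * k)) w := by
  refine Q.commute_all ?_ ((Commute.refl _).pow_left _) (fun r => ?_) w
  · have h : (fun _ => 1 : ZMod m → K) = 1 := rfl
    refine (Q.b_pow_mul_a _).trans ?_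
    rw [stepProd_full_mul c (-1) (by ring), hc, h, map_one, mul_one]
  · refine Eq.symm ((Q.ε_mul_b_pow r _).trans ?_)
    simp

/-- If `∏ c` is a root of unity, then large powers of `a` and `b` are central of even degree, and
the monomials of small degree generate over them. -/
theorem finite_of_pow_eq_one (Q : QuantumPlane K m c A) {d : ℕ} (hd : 0 < d)
    (hc : (∏ i, c i) ^ d = 1) : Module.Finite (gradedCentreOf A) (⨁ n, A n) := by
  -- The exponent `N = m k` is even, so that no signs occur, and a multiple of `m`, so that the
  -- powers `a ^ N` and `b ^ N` commute with the scalars.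
  set k := 2 * d with hk
  have hek : Even k := even_two_mul d
  have hck : (∏ i, c i) ^ k = 1 := by rw [hk, mul_comm, pow_mul, hc, one_pow]
  set N := m * k with hN
  have hN0 : 0 < N := Nat.mul_pos (NeZero.pos m) (by lia)
  let gen : Fin N × Fin N × ZMod m → ⨁ n, A n := fun x =>
    Q.a ^ (x.1 : ℕ) * Q.b ^ (x.2.1 : ℕ) * Q.ε (Pi.single x.2.2 1)
  have key : ∀ s t r, Q.a ^ s * Q.b ^ t * Q.ε r ∈
      Submodule.span (gradedCentreOf A) (Set.range gen) := by
    intro s t r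
    have hr : r = ∑ i, (fun _ => r i) * Pi.single i 1 := by
      funext j
      simp [Finset.sum_apply, Pi.single_apply]
    rw [hr, map_sum, mul_sum]
    refine sum_mem fun i _ => ?_
    have hA := Subring.pow_mem _ (mem_gradedCentreOf (hek.mul_left m) (pow_mem_homog Q.a_mem _)
      (Q.commute_a_pow hck)) (s / N)
    have hB := Subring.pow_mem _ (mem_gradedCentreOf (hek.mul_left m) (pow_mem_homog Q.b_mem _)
      (Q.commute_b_pow hck)) (t / N)
    have hC := mem_gradedCentreOf Even.zero (Q.ε_mem _) (Q.commute_ε_const (r i))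
    have hmem := Submodule.smul_mem _
      (⟨_, Subring.mul_mem _ (Subring.mul_mem _ hA hB) hC⟩ : gradedCentreOf A)
      (Submodule.subset_span (R := gradedCentreOf A) (Set.mem_range_self (f := gen)
        (⟨s % N, Nat.mod_lt _ hN0⟩, ⟨t % N, Nat.mod_lt _ hN0⟩, i)))
    convert hmem using 1
    rw [Subring.smul_def, smul_eq_mul]
    have hs : Q.a ^ s = (Q.a ^ N) ^ (s / N) * Q.a ^ (s % N) := by
      rw [← pow_mul, ← pow_add, Nat.div_add_mod]
    have ht : Q.b ^ t = (Q.b ^ N) ^ (t / N) * Q.b ^ (t % N) := by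
      rw [← pow_mul, ← pow_add, Nat.div_add_mod]
    have hBc : ∀ w, Commute w ((Q.b ^ N) ^ (t / N)) := fun w =>
      ((Q.commute_b_pow hck w).pow_left _).symm
    have hCc : ∀ w, Commute w (Q.ε (fun _ => r i)) := fun w => (Q.commute_ε_const (r i) w).symm
    rw [map_mul, hs, ht]
    simp only [mul_assoc, gen, ← hN]
    rw [(hCc _).left_comm, (hBc _).left_comm, (hCc (Q.a ^ (s % N))).left_comm]
  refine ⟨Submodule.fg_def.mpr ⟨_, Set.finite_range gen, eq_top_iff.mpr fun z _ => ?_⟩⟩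
  induction z using DirectSum.induction_on with
  | zero => exact zero_mem _
  | of n g =>
    obtain ⟨r, hr⟩ := Q.exists_poly n (of_mem_homog g)
    rw [hr, poly]
    exact sum_mem fun s _ => key _ _ _
  | add w w' h h' => exact add_mem (h trivial) (h' trivial)

/-- A twisted quantum plane is finite over its graded centre exactly when the product of the
commutation parameters around the cycle is a root of unity. -/
theorem finite_iff (Q : QuantumPlane K m c A) (hc : ∀ i, c i ≠ 0) :
    Module.Finite (gradedCentreOf A) (⨁ n, A n) ↔ ∃ d, 0 < d ∧ (∏ i, c i) ^ d = 1 :=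
  ⟨fun _ => Q.exists_pow_eq_one_of_finite hc, fun ⟨_, hd, h⟩ => Q.finite_of_pow_eq_one hd h⟩

end QuantumPlane

end

/-! ### The Ext algebra as a quantum plane -/

section YonedaProduct

open Abelian

variable {C : Type*} [Category* C] [Abelian C] [HasExt.{u} C] {X : C}

/-- A class in `Ext^n(X, X)`, as an element of the Ext algebra. -/
def ofExt {n : ℕ} (e : Ext X X n) : ⨁ n, SelfExt X n := DirectSum.of (SelfExt X) n e

theorem ofExt_comp {i j k : ℕ} (e : Ext X X i) (f : Ext X X j) (h : i + j = k) :
    ofExt (e.comp f h) = ofExt e * ofExt f := by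
  subst h
  exact (DirectSum.of_mul_of (A := SelfExt X) _ _).symm

theorem ofExt_add {i : ℕ} (e f : Ext X X i) : ofExt (e + f) = ofExt e + ofExt f :=
  map_add (DirectSum.of (SelfExt X) i) _ _

theorem ofExt_injective {n : ℕ} : Function.Injective (ofExt (X := X) (n := n)) :=
  DirectSum.of_injective n

theorem ofExt_mem_homog {n : ℕ} (e : Ext X X n) : ofExt e ∈ homog (SelfExt X) n :=
  of_mem_homog (A := SelfExt X) e

theorem exists_ofExt {n : ℕ} {z : ⨁ n, SelfExt X n} (hz : z ∈ homog (SelfExt X) n) :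
    ∃ e : Ext X X n, z = ofExt e := by
  obtain ⟨e, rfl⟩ := hz
  exact ⟨e, rfl⟩

theorem ofExt_eq_zero {n : ℕ} {e : Ext X X n} (h : ofExt e = 0) : e = 0 :=
  ofExt_injective (h.trans (map_zero (DirectSum.of (SelfExt X) n)).symm)

end YonedaProduct

namespace QuantumExterior

open Abelian

variable {R : Type*} {Γ : Type u} [CommRing R] [Ring Γ] {σ : R ≃+* R}
  {q : Rˣ} (P : QuantumExterior R Γ σ q)

/-- The scalars of the Ext algebra. -/
def extScalarHom : R →+* ⨁ n, SelfExt (radicalQuotient Γ) n :=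
  RingHom.mk'
    { toFun := fun r => ofExt (P.extScalar r)
      map_one' := by
        rw [extScalar, P.scalar_one]
        rfl
      map_mul' := fun r s => by
        have h := extOfLinear_comp (P.scalar r) (P.scalar s)
        rw [P.scalar_comp] at h
        exact (congrArg ofExt h.symm).trans (ofExt_comp _ _ (zero_add 0)) }
    fun r s => by
      change ofExt _ = ofExt _ + ofExt _
      rw [← ofExt_add, extScalar, P.scalar_add, extOfLinear_add]
      rfl

theorem extScalarHom_apply (r : R) : P.extScalarHom r = ofExt (P.extScalar r) := rfl

variable [IsSemisimpleRing R]

theorem ofExt_extYPow (n : ℕ) (r : R) :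
    ofExt (P.extYPow n r) = ofExt P.extY ^ n * P.extScalarHom r := by
  induction n with
  | zero => rw [pow_zero, one_mul, extYPow, extScalarHom_apply]
  | succ n ih => rw [extYPow, ofExt_comp, ih, pow_succ', mul_assoc]

/-- The Ext algebra of a quantum exterior algebra is a quantum plane. -/
def quantumPlane {K : Type*} [Field K] {m : ℕ} [NeZero m] {q : (ZMod m → K)ˣ}
    (P : QuantumExterior (ZMod m → K) Γ (shift K m) q) :
    QuantumPlane K m (-q) (SelfExt (radicalQuotient Γ)) where
  ε := P.extScalarHom
  a := ofExt P.extX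
  b := ofExt P.extY
  ε_mem _ := ofExt_mem_homog _
  a_mem := ofExt_mem_homog _
  b_mem := ofExt_mem_homog _
  exists_ε z hz := by
    obtain ⟨e, rfl⟩ := exists_ofExt hz
    obtain ⟨f, rfl⟩ := exists_extOfLinear e
    obtain ⟨r, rfl⟩ := P.exists_scalar f
    exact ⟨r, rfl⟩
  ε_inj r h := by
    have h := extOfLinear_eq_zero.mp (ofExt_eq_zero h)
    exact P.scalar_injective (by rw [h, LinearMap.zero_comp])
  ε_mul_a r := by
    rw [extScalarHom_apply, ← ofExt_comp _ _ (zero_add 1), P.extScalar_comp_extX, ofExt_comp,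
      extScalarHom_apply]
  ε_mul_b r := by
    rw [extScalarHom_apply, ← ofExt_comp _ _ (zero_add 1), P.extScalar_comp_extY, ofExt_comp,
      extScalarHom_apply]
  b_mul_a := by
    rw [extScalarHom_apply, ← ofExt_comp _ _ rfl, P.extY_comp_extX, ofExt_comp, ofExt_comp]
  exists_add n z hz := by
    obtain ⟨e, rfl⟩ := exists_ofExt hz
    obtain ⟨g, r, rfl⟩ := P.exists_extX_comp_add n e
    exact ⟨ofExt g, ofExt_mem_homog g, r, by rw [ofExt_add, ofExt_comp, ofExt_extYPow]⟩
  eq_zero n w hw r h := by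
    obtain ⟨g, rfl⟩ := exists_ofExt hw
    rw [← ofExt_extYPow, ← ofExt_comp _ _ (Nat.add_comm 1 n), ← ofExt_add] at h
    obtain ⟨rfl, hr⟩ := P.extX_comp_add_eq_zero (ofExt_eq_zero h)
    exact ⟨map_zero (DirectSum.of (SelfExt (radicalQuotient Γ)) n), hr⟩

end QuantumExterior

/-! ### Homomorphisms out of a path algebra -/

namespace PathAlgebra

variable (K : Type u) [Field K] {V : Type} [Quiver.{0} V]

theorem ofPath_mul_of_ne {p r : QuiverPath V} (h : r.src ≠ p.tgt) :
    ofPath K p * ofPath K r = 0 := by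
  rw [ofPath_mul_ofPath, pathMul, dif_neg h]

theorem ofPath_cons {i j k : V} (p : Quiver.Path i j) (e : j ⟶ k) :
    ofPath K ⟨i, k, p.cons e⟩ = ofPath K ⟨i, j, p⟩ * ofPath K ⟨j, k, e.toPath⟩ := by
  rw [ofPath_mul_ofPath, pathMul, dif_pos rfl]
  rfl

/-- The image of a path under the assignment `f` of the vertices and `g` of the arrows. -/
def pathImage {B : Type*} [Ring B] (f : V → B) (g : ∀ {i j : V}, (i ⟶ j) → B) {i : V} :
    ∀ {j : V}, Quiver.Path i j → B
  | _, .nil => f i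
  | _, .cons p e => pathImage f g p * g e

section Lift

variable {B : Type*} [Ring B] [Algebra K B] (f : V → B) (g : ∀ {i j : V}, (i ⟶ j) → B)

variable {f g}

theorem mul_pathImage (hg : ∀ {i j : V} (e : i ⟶ j), f i * g e = g e)
    (hff : ∀ i, f i * f i = f i) {i j : V} (p : Quiver.Path i j) :
    f i * pathImage f g p = pathImage f g p := by
  induction p with
  | nil => exact hff _
  | cons p e ih =>
    cases p with
    | nil => rw [pathImage, pathImage, hg, hg]
    | cons p e' => rw [pathImage, ← mul_assoc, ih]

theorem pathImage_mul (hg : ∀ {i j : V} (e : i ⟶ j), g e * f j = g e)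
    (hff : ∀ i, f i * f i = f i) {i j : V} (p : Quiver.Path i j) :
    pathImage f g p * f j = pathImage f g p := by
  cases p with
  | nil => exact hff _
  | cons p e => rw [pathImage, mul_assoc, hg]

theorem pathImage_comp (hg : ∀ {i j : V} (e : i ⟶ j), g e * f j = g e)
    (hff : ∀ i, f i * f i = f i) {i j k : V} (p : Quiver.Path i j) (r : Quiver.Path j k) :
    pathImage f g (p.comp r) = pathImage f g p * pathImage f g r := by
  induction r with
  | nil => exact (pathImage_mul hg hff p).symm
  | cons r e ih => rw [Quiver.Path.comp_cons, pathImage, ih, pathImage, mul_assoc]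

variable (f g)

/-- The linear extension of `pathImage`. -/
def liftLinear : PathAlgebra K V →ₗ[K] B :=
  (Finsupp.linearCombination K fun p : QuiverPath V => pathImage f g p.path :
    (QuiverPath V →₀ K) →ₗ[K] B)

theorem liftLinear_ofPath (p : QuiverPath V) :
    liftLinear K f g (ofPath K p) = pathImage f g p.path :=
  (Finsupp.linearCombination_single K (1 : K) p).trans (one_smul K _)

variable {f g}

theorem liftLinear_mul (hg : ∀ {i j : V} (e : i ⟶ j), g e * f j = g e)
    (hg' : ∀ {i j : V} (e : i ⟶ j), f i * g e = g e)
    (hff : ∀ i, f i * f i = f i) (hf : ∀ i j, i ≠ j → f i * f j = 0) (x y : PathAlgebra K V) :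
    liftLinear K f g (x * y) = liftLinear K f g x * liftLinear K f g y := by
  induction x using induction_on with
  | h0 => rw [zero_mul', map_zero, zero_mul]
  | hadd x₁ x₂ h₁ h₂ => rw [add_mul', map_add, map_add, h₁, h₂, add_mul]
  | hof c p =>
    induction y using induction_on with
    | h0 => rw [mul_zero', map_zero, mul_zero]
    | hadd y₁ y₂ h₁ h₂ => rw [mul_add', map_add, map_add, h₁, h₂, mul_add]
    | hof d r =>
      rw [smul_mul', mul_smul', map_smul, map_smul, map_smul, map_smul, smul_mul_smul_comm,
        smul_smul]
      congr 1
      obtain ⟨i, j, p⟩ := p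
      obtain ⟨k, l, r⟩ := r
      by_cases h : k = j
      · subst h
        rw [ofPath_mul_ofPath, pathMul, dif_pos rfl, liftLinear_ofPath, liftLinear_ofPath,
          liftLinear_ofPath]
        exact pathImage_comp hg hff p r
      · rw [ofPath_mul_of_ne K h, map_zero, liftLinear_ofPath, liftLinear_ofPath,
          ← pathImage_mul hg hff p, ← mul_pathImage hg' hff r, mul_assoc, ← mul_assoc (f j),
          hf j k (Ne.symm h), zero_mul, mul_zero]

variable [Fintype V]

theorem liftLinear_one (hone : ∑ i, f i = 1) : liftLinear K f g 1 = 1 := by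
  change liftLinear K f g (∑ v : V, ofPath K ⟨v, v, Quiver.Path.nil⟩) = 1
  rw [map_sum, ← hone]
  exact Finset.sum_congr rfl fun v _ => liftLinear_ofPath K f g _

/-- The universal property of the path algebra: an algebra homomorphism is determined by a complete
family `f` of orthogonal idempotents indexed by the vertices, and by elements `g e` compatible with
the source and the target of each arrow `e`. -/
def lift (hg : ∀ {i j : V} (e : i ⟶ j), g e * f j = g e)
    (hg' : ∀ {i j : V} (e : i ⟶ j), f i * g e = g e) (hff : ∀ i, f i * f i = f i)
    (hf : ∀ i j, i ≠ j → f i * f j = 0) (hone : ∑ i, f i = 1) : PathAlgebra K V →ₐ[K] B :=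
  AlgHom.ofLinearMap (liftLinear K f g) (liftLinear_one K hone) (liftLinear_mul K hg hg' hff hf)

end Lift

section VertexScalars

variable [Fintype V]

/-- A function on the vertices, as a combination of trivial paths. -/
def vertexSum (r : V → K) : PathAlgebra K V :=
  ∑ v, r v • ofPath K ⟨v, v, Quiver.Path.nil⟩

theorem vertexSum_mul_ofPath (r : V → K) (p : QuiverPath V) :
    vertexSum K r * ofPath K p = r p.src • ofPath K p := by
  rw [vertexSum, sum_mul', Finset.sum_eq_single p.src]
  · rw [smul_mul', ofPath_mul_ofPath, pathMul, dif_pos rfl]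
    congr 2
    obtain ⟨i, j, p⟩ := p
    simp
  · intro v _ hv
    rw [smul_mul', ofPath_mul_of_ne K (Ne.symm hv), smul_zero]
  · simp

theorem ofPath_mul_vertexSum (r : V → K) (p : QuiverPath V) :
    ofPath K p * vertexSum K r = r p.tgt • ofPath K p := by
  rw [vertexSum, mul_sum', Finset.sum_eq_single p.tgt]
  · rw [mul_smul', ofPath_mul_ofPath, pathMul, dif_pos rfl]
    rfl
  · intro v _ hv
    rw [mul_smul', ofPath_mul_of_ne K hv, smul_zero]
  · simp

/-- Functions on the vertices embed in the path algebra. -/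
def vertexHom : (V → K) →+* PathAlgebra K V :=
  RingHom.mk'
    { toFun := vertexSum K
      map_one' := Finset.sum_congr rfl fun v _ => one_smul K _
      map_mul' := fun r s => by
        conv_rhs => rw [vertexSum.eq_def K s, mul_sum']
        refine Finset.sum_congr rfl fun v _ => ?_
        rw [mul_smul', vertexSum_mul_ofPath, smul_smul, Pi.mul_apply, mul_comm] }
    fun r s => by
      change vertexSum K _ = vertexSum K _ + vertexSum K _
      simp only [vertexSum, Pi.add_apply, add_smul, Finset.sum_add_distrib]

theorem vertexHom_mul_ofPath (r : V → K) (p : QuiverPath V) :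
    vertexHom K r * ofPath K p = r p.src • ofPath K p := vertexSum_mul_ofPath K r p

theorem ofPath_mul_vertexHom (r : V → K) (p : QuiverPath V) :
    ofPath K p * vertexHom K r = r p.tgt • ofPath K p := ofPath_mul_vertexSum K r p

theorem ofPath_nil [DecidableEq V] (v : V) :
    ofPath K ⟨v, v, Quiver.Path.nil⟩ = vertexHom K (Pi.single v 1) := by
  change _ = ∑ w, _
  rw [Finset.sum_eq_single v]
  · simp
  · intro w _ hw
    simp [hw]
  · simp

end VertexScalars

end PathAlgebra

/-! ### The algebra `Λ_q` -/

section SocleDeformation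

open PathAlgebra

variable {K : Type u} [Field K] {m : ℕ}

/-- The units of `K ^ (ℤ / m)` are the families of units. -/
def unitsOfFamily (q : ZMod m → Kˣ) : (ZMod m → K)ˣ := MulEquiv.piUnits.symm q

theorem unitsOfFamily_apply (q : ZMod m → Kˣ) (i : ZMod m) :
    (unitsOfFamily q : ZMod m → K) i = q i := rfl

theorem single_mul_shift_single (i : ZMod m) :
    Pi.single i 1 * shift K m (Pi.single (i + 1) 1) = Pi.single i 1 := by
  funext j
  rcases eq_or_ne j i with rfl | h
  · simp [shift_apply]
  · simp [h]

theorem single_mul_shift_symm_single (i : ZMod m) :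
    Pi.single (i + 1) 1 * (shift K m).symm (Pi.single i 1) = Pi.single (i + 1) 1 := by
  funext j
  rcases eq_or_ne j (i + 1) with rfl | h
  · simp [shift_symm_apply]
  · simp [h]

/-- The image of an arrow in a ring carrying the relations of a quantum exterior algebra: `a i` is
sent to `e_i x` and `ā i` to `e_{i + 1} y`. -/
def arrowImage {B : Type*} [Ring B] {q : ZMod m → Kˣ}
    (P : QuantumRel (ZMod m → K) B (shift K m) (unitsOfFamily q)) :
    ∀ {i j : CyclicVertex m}, (i ⟶ j) → B
  | _, _, .a i => P.ι (Pi.single i 1) * P.x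
  | _, _, .abar i => P.ι (Pi.single (i + 1) 1) * P.y

theorem arrowImage_mul {B : Type*} [Ring B] {q : ZMod m → Kˣ}
    (P : QuantumRel (ZMod m → K) B (shift K m) (unitsOfFamily q)) :
    ∀ {i j : CyclicVertex m} (e : i ⟶ j),
    arrowImage P e * P.ι (Pi.single j 1) = arrowImage P e
  | _, _, .a i => by
    rw [arrowImage, mul_assoc, P.x_mul_ι, ← mul_assoc, ← map_mul, single_mul_shift_single]
  | _, _, .abar i => by
    rw [arrowImage, mul_assoc, P.y_mul_ι, ← mul_assoc, ← map_mul, single_mul_shift_symm_single]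

theorem mul_arrowImage {B : Type*} [Ring B] {q : ZMod m → Kˣ}
    (P : QuantumRel (ZMod m → K) B (shift K m) (unitsOfFamily q)) :
    ∀ {i j : CyclicVertex m} (e : i ⟶ j),
    P.ι (Pi.single i 1) * arrowImage P e = arrowImage P e
  | _, _, .a i => by rw [arrowImage, ← mul_assoc, ← map_mul, ← Pi.single_mul, one_mul]
  | _, _, .abar i => by rw [arrowImage, ← mul_assoc, ← map_mul, ← Pi.single_mul, one_mul]

/-- The underlying space of the left regular representation, in the coordinates
`1, x, y, xy`. -/
abbrev SocleCoord (K : Type u) (m : ℕ) : Type u :=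
  (ZMod m → K) × (ZMod m → K) × (ZMod m → K) × (ZMod m → K)

/-- The left regular representation of the quantum exterior algebra, written in coordinates. -/
def regularRel (q : ZMod m → Kˣ) :
    QuantumRel (ZMod m → K) (Module.End K (SocleCoord K m)) (shift K m) (unitsOfFamily q) where
  ι := Module.toModuleEnd K (S := ZMod m → K) (SocleCoord K m)
  x :=
    { toFun := fun v => (0, shift K m v.1, 0, shift K m v.2.2.1)
      map_add' := fun v w => by simp
      map_smul' := fun k v => by
        ext <;> simp [shift_apply] }
  y :=
    { toFun := fun v =>
        (0, 0, (shift K m).symm v.1, (unitsOfFamily q : ZMod m → K) * (shift K m).symm v.2.1)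
      map_add' := fun v w => by simp [mul_add]
      map_smul' := fun k v => by
        ext <;> simp [shift_symm_apply, mul_left_comm] }
  x_mul_ι r := by
    refine LinearMap.ext fun v => ?_
    ext <;> simp [shift_apply]
  y_mul_ι r := by
    refine LinearMap.ext fun v => ?_
    ext <;> simp [shift_symm_apply, mul_left_comm]
  x_mul_x := by
    refine LinearMap.ext fun v => ?_
    ext <;> simp
  y_mul_y := by
    refine LinearMap.ext fun v => ?_
    ext <;> simp
  y_mul_x := by
    refine LinearMap.ext fun v => ?_
    ext <;> simp

theorem regularRel_ι_smul (q : ZMod m → Kˣ) (k : K) (r : ZMod m → K) :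
    (regularRel q).ι (k • r) = k • (regularRel q).ι r :=
  LinearMap.ext fun v => smul_assoc k r v

variable [NeZero m]

theorem sum_single_one : ∑ i : ZMod m, Pi.single i (1 : K) = 1 :=
  Finset.univ_sum_single (1 : ZMod m → K)

section Lift

variable {B : Type*} [Ring B] [Algebra K B] {q : ZMod m → Kˣ}
    (P : QuantumRel (ZMod m → K) B (shift K m) (unitsOfFamily q))

/-- A ring carrying the relations of a quantum exterior algebra receives a map from the path
algebra. -/
def pathLift : PathAlgebra K (CyclicVertex m) →ₐ[K] B :=
  PathAlgebra.lift K (f := fun i => P.ι (Pi.single i 1)) (g := arrowImage P)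
    (arrowImage_mul P) (mul_arrowImage P)
    (fun i => by rw [← map_mul, ← Pi.single_mul, one_mul])
    (fun i j h => by
      have : (Pi.single i 1 * Pi.single j 1 : ZMod m → K) = 0 := by
        funext k
        rcases eq_or_ne k i with rfl | hk
        · simp [h]
        · simp [hk]
      rw [← map_mul, this, map_zero])
    (by
      rw [← map_sum, sum_single_one, map_one])

theorem pathLift_ofPath (p : QuiverPath (CyclicVertex m)) :
    pathLift P (ofPath K p) =
      pathImage (fun i => P.ι (Pi.single i 1)) (arrowImage P) p.path :=
  liftLinear_ofPath K _ _ p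

theorem pathLift_nil (i : ZMod m) :
    pathLift P (ofPath K ⟨i, i, Quiver.Path.nil⟩) = P.ι (Pi.single i 1) :=
  pathLift_ofPath P _

theorem pathLift_arrowA (i : ZMod m) : pathLift P (arrowA K m i) = P.ι (Pi.single i 1) * P.x := by
  refine (pathLift_ofPath P _).trans ?_
  change P.ι (Pi.single i 1) * (P.ι (Pi.single i 1) * P.x) = _
  rw [← mul_assoc, ← map_mul, ← Pi.single_mul, one_mul]

theorem pathLift_arrowAbar (i : ZMod m) :
    pathLift P (arrowAbar K m i) = P.ι (Pi.single (i + 1) 1) * P.y := by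
  refine (pathLift_ofPath P _).trans ?_
  change P.ι (Pi.single (i + 1) 1) * (P.ι (Pi.single (i + 1) 1) * P.y) = _
  rw [← mul_assoc, ← map_mul, ← Pi.single_mul, one_mul]

theorem pathLift_rel (hι : ∀ (k : K) (r : ZMod m → K), P.ι (k • r) = k • P.ι r)
    {z w : PathAlgebra K (CyclicVertex m)} (h : SocleRel K m q z w) :
    pathLift P z = pathLift P w := by
  cases h with
  | a_a i =>
    rw [map_mul, pathLift_arrowA, pathLift_arrowA, map_zero, mul_assoc, ← mul_assoc P.x,
      P.x_mul_ι, mul_assoc _ P.x, P.x_mul_x, mul_zero, mul_zero]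
  | abar_abar i =>
    rw [map_mul, pathLift_arrowAbar, pathLift_arrowAbar, map_zero, mul_assoc, ← mul_assoc P.y,
      P.y_mul_ι, mul_assoc _ P.y, P.y_mul_y, mul_zero, mul_zero]
  | a_abar i =>
    have hq : (q i : K) • (Pi.single i 1 : ZMod m → K) =
        Pi.single i 1 * (unitsOfFamily q : ZMod m → K) := by
      funext j
      rcases eq_or_ne j i with rfl | h
      · simp [unitsOfFamily_apply]
      · simp [h]
    have h1 : P.ι (Pi.single i 1) * P.x * (P.ι (Pi.single (i + 1) 1) * P.y) =
        P.ι (Pi.single i 1) * (P.x * P.y) := by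
      rw [mul_assoc, ← mul_assoc P.x, P.x_mul_ι, ← mul_assoc, ← mul_assoc, ← map_mul,
        single_mul_shift_single, mul_assoc]
    have h2 : P.ι (Pi.single (i - 1 + 1) 1) * P.y * (P.ι (Pi.single (i - 1) 1) * P.x) =
        P.ι (Pi.single i 1) * (P.y * P.x) := by
      rw [mul_assoc, ← mul_assoc P.y, P.y_mul_ι, ← mul_assoc, ← mul_assoc, ← map_mul,
        single_mul_shift_symm_single, mul_assoc, sub_add_cancel]
    rw [map_smul, map_mul, map_mul, pathLift_arrowA, pathLift_arrowA, pathLift_arrowAbar,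
      pathLift_arrowAbar, h1, h2, P.y_mul_x, ← mul_assoc (P.ι _) (P.ι _), ← map_mul, ← hq, hι,
      smul_mul_assoc]

end Lift

/-- The sum of the arrows `a i`. -/
def sumA (K : Type u) [Field K] (m : ℕ) [NeZero m] : PathAlgebra K (CyclicVertex m) :=
  ∑ i : ZMod m, arrowA K m i

/-- The sum of the arrows `ā i`. -/
def sumAbar (K : Type u) [Field K] (m : ℕ) [NeZero m] : PathAlgebra K (CyclicVertex m) :=
  ∑ i : ZMod m, arrowAbar K m i

theorem vertexHom_mul_arrowA (r : ZMod m → K) (i : ZMod m) :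
    vertexHom K (V := CyclicVertex m) r * arrowA K m i = r i • arrowA K m i :=
  vertexHom_mul_ofPath K (V := CyclicVertex m) r _

theorem arrowA_mul_vertexHom (r : ZMod m → K) (i : ZMod m) :
    arrowA K m i * vertexHom K (V := CyclicVertex m) r = r (i + 1) • arrowA K m i :=
  ofPath_mul_vertexHom K (V := CyclicVertex m) r _

theorem vertexHom_mul_arrowAbar (r : ZMod m → K) (i : ZMod m) :
    vertexHom K (V := CyclicVertex m) r * arrowAbar K m i = r (i + 1) • arrowAbar K m i :=
  vertexHom_mul_ofPath K (V := CyclicVertex m) r _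

theorem arrowAbar_mul_vertexHom (r : ZMod m → K) (i : ZMod m) :
    arrowAbar K m i * vertexHom K (V := CyclicVertex m) r = r i • arrowAbar K m i :=
  ofPath_mul_vertexHom K (V := CyclicVertex m) r _

theorem sumA_mul_sumAbar :
    sumA K m * sumAbar K m = ∑ i : ZMod m, arrowA K m i * arrowAbar K m i := by
  rw [sumA, sumAbar, Finset.sum_mul_sum]
  refine Finset.sum_congr rfl fun i _ => Finset.sum_eq_single i (fun j _ h => ?_) (by simp)
  exact ofPath_mul_of_ne K fun h' => h (add_right_cancel h')

theorem sumAbar_mul_sumA :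
    sumAbar K m * sumA K m = ∑ i : ZMod m, arrowAbar K m (i - 1) * arrowA K m (i - 1) := by
  rw [sumA, sumAbar, Finset.sum_mul_sum, ← (Equiv.subRight (1 : ZMod m)).sum_comp]
  refine Finset.sum_congr rfl fun i _ =>
    Finset.sum_eq_single (i - 1) (fun j _ h => ofPath_mul_of_ne K h) (by simp)

/-- The scalars and the two sums of arrows satisfy the relations of a quantum exterior algebra. -/
def socleQuantumRel (q : ZMod m → Kˣ) :
    QuantumRel (ZMod m → K) (SocleDeformation K m q) (shift K m) (unitsOfFamily q) where
  ι := (RingQuot.mkAlgHom K (SocleRel K m q) : _ →+* _).comp (vertexHom K (V := CyclicVertex m))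
  x := RingQuot.mkAlgHom K (SocleRel K m q) (sumA K m)
  y := RingQuot.mkAlgHom K (SocleRel K m q) (sumAbar K m)
  x_mul_ι r := by
    change RingQuot.mkAlgHom K (SocleRel K m q) _ * RingQuot.mkAlgHom K (SocleRel K m q) _ =
      RingQuot.mkAlgHom K (SocleRel K m q) _ * RingQuot.mkAlgHom K (SocleRel K m q) _
    rw [← map_mul, ← map_mul, sumA, Finset.sum_mul, Finset.mul_sum]
    congr 1
    refine Finset.sum_congr rfl fun i _ => ?_
    rw [arrowA_mul_vertexHom, vertexHom_mul_arrowA, shift_apply]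
  y_mul_ι r := by
    change RingQuot.mkAlgHom K (SocleRel K m q) _ * RingQuot.mkAlgHom K (SocleRel K m q) _ =
      RingQuot.mkAlgHom K (SocleRel K m q) _ * RingQuot.mkAlgHom K (SocleRel K m q) _
    rw [← map_mul, ← map_mul, sumAbar, Finset.sum_mul, Finset.mul_sum]
    congr 1
    refine Finset.sum_congr rfl fun i _ => ?_
    rw [arrowAbar_mul_vertexHom, vertexHom_mul_arrowAbar, shift_symm_apply, add_sub_cancel_right]
  x_mul_x := by
    rw [← map_mul, sumA, Finset.sum_mul_sum, map_sum]
    refine Finset.sum_eq_zero fun i _ => ?_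
    rw [map_sum]
    refine Finset.sum_eq_zero fun j _ => ?_
    rcases eq_or_ne j (i + 1) with rfl | h
    · rw [RingQuot.mkAlgHom_rel K (SocleRel.a_a i), map_zero]
    · have : arrowA K m i * arrowA K m j = 0 := ofPath_mul_of_ne K h
      rw [this, map_zero]
  y_mul_y := by
    rw [← map_mul, sumAbar, Finset.sum_mul_sum, map_sum]
    refine Finset.sum_eq_zero fun i _ => ?_
    rw [map_sum]
    refine Finset.sum_eq_zero fun j _ => ?_
    rcases eq_or_ne (j + 1) i with rfl | h
    · have hrel := RingQuot.mkAlgHom_rel K (SocleRel.abar_abar (q := q) (j + 1 + 1))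
      have h1 : j + 1 + 1 - 1 = j + 1 := by ring
      have h2 : j + 1 + 1 - 2 = j := by ring
      rw [h1, h2, map_zero] at hrel
      exact hrel
    · have : arrowAbar K m i * arrowAbar K m j = 0 := ofPath_mul_of_ne K h
      rw [this, map_zero]
  y_mul_x := by
    change _ = RingQuot.mkAlgHom K (SocleRel K m q) _ * _
    rw [← map_mul, ← map_mul, ← map_mul, sumAbar_mul_sumA, sumA_mul_sumAbar, Finset.mul_sum,
      map_sum, map_sum]
    refine Finset.sum_congr rfl fun i _ => ?_
    rw [← RingQuot.mkAlgHom_rel K (SocleRel.a_abar (q := q) i), ← mul_assoc, vertexHom_mul_arrowA,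
      smul_mul_assoc, unitsOfFamily_apply]

theorem socleQuantumRel_ι (q : ZMod m → Kˣ) (r : ZMod m → K) : (socleQuantumRel q).ι r =
    RingQuot.mkAlgHom K (SocleRel K m q) (vertexHom K (V := CyclicVertex m) r) := rfl

theorem mkAlgHom_arrowA (q : ZMod m → Kˣ) (i : ZMod m) :
    RingQuot.mkAlgHom K (SocleRel K m q) (arrowA K m i) =
      (socleQuantumRel q).x * (socleQuantumRel q).ι (Pi.single (i + 1) 1) := by
  change _ = RingQuot.mkAlgHom K (SocleRel K m q) _ * RingQuot.mkAlgHom K (SocleRel K m q) _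
  rw [← map_mul, sumA, Finset.sum_mul, Finset.sum_eq_single i]
  · rw [arrowA_mul_vertexHom, Pi.single_eq_same, one_smul]
  · intro j _ h
    rw [arrowA_mul_vertexHom, Pi.single_eq_of_ne (fun h' => h (add_right_cancel h')), zero_smul]
  · simp

theorem mkAlgHom_arrowAbar (q : ZMod m → Kˣ) (i : ZMod m) :
    RingQuot.mkAlgHom K (SocleRel K m q) (arrowAbar K m i) =
      (socleQuantumRel q).y * (socleQuantumRel q).ι (Pi.single i 1) := by
  change _ = RingQuot.mkAlgHom K (SocleRel K m q) _ * RingQuot.mkAlgHom K (SocleRel K m q) _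
  rw [← map_mul, sumAbar, Finset.sum_mul, Finset.sum_eq_single i]
  · rw [arrowAbar_mul_vertexHom, Pi.single_eq_same, one_smul]
  · intro j _ h
    rw [arrowAbar_mul_vertexHom, Pi.single_eq_of_ne h, zero_smul]
  · simp

theorem socle_exists_elem_mul_arrow (q : ZMod m → Kˣ) : ∀ {i j : CyclicVertex m} (e : i ⟶ j)
    (a b c d : ZMod m → K), ∃ a' b' c' d', (socleQuantumRel q).elem a b c d *
      RingQuot.mkAlgHom K (SocleRel K m q) (ofPath K ⟨i, j, e.toPath⟩) =
        (socleQuantumRel q).elem a' b' c' d'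
  | _, _, .a k, a, b, c, d => by
    have h := congrArg ((socleQuantumRel q).elem a b c d * ·) (mkAlgHom_arrowA q k)
    rw [← mul_assoc, QuantumRel.elem_mul_x, QuantumRel.elem_mul_ι] at h
    exact ⟨_, _, _, _, h⟩
  | _, _, .abar k, a, b, c, d => by
    have h := congrArg ((socleQuantumRel q).elem a b c d * ·) (mkAlgHom_arrowAbar q k)
    rw [← mul_assoc, QuantumRel.elem_mul_y, QuantumRel.elem_mul_ι] at h
    exact ⟨_, _, _, _, h⟩

/-- Every path is a combination of `1, x, y, xy` modulo the relations. -/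
theorem socle_exists_elem_ofPath (q : ZMod m → Kˣ) {i j : CyclicVertex m} (p : Quiver.Path i j) :
    ∃ a b c d, RingQuot.mkAlgHom K (SocleRel K m q) (ofPath K ⟨i, j, p⟩) =
      (socleQuantumRel q).elem a b c d := by
  induction p with
  | nil =>
    refine ⟨Pi.single i 1, 0, 0, 0, ?_⟩
    rw [ofPath_nil, ← socleQuantumRel_ι, QuantumRel.ι_eq_elem]
  | cons p e ih =>
    obtain ⟨a, b, c, d, h⟩ := ih
    rw [ofPath_cons, map_mul, h]
    exact socle_exists_elem_mul_arrow q e a b c d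

theorem smul_elem (q : ZMod m → Kˣ) (k : K) (a b c d : ZMod m → K) :
    k • (socleQuantumRel q).elem a b c d =
      (socleQuantumRel q).elem (k • a) (k • b) (k • c) (k • d) := by
  have h : ∀ r : ZMod m → K, (socleQuantumRel q).ι (k • r) = k • (socleQuantumRel q).ι r := by
    intro r
    rw [socleQuantumRel_ι, socleQuantumRel_ι, ← map_smul]
    congr 1
    change vertexSum K _ = k • vertexSum K _
    rw [vertexSum, vertexSum, Finset.smul_sum]
    exact Finset.sum_congr rfl fun v _ => mul_smul _ _ _
  simp only [QuantumRel.elem, h, smul_add, smul_mul_assoc]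

theorem socle_exists_elem (q : ZMod m → Kˣ) (g : SocleDeformation K m q) :
    ∃ a b c d, g = (socleQuantumRel q).elem a b c d := by
  obtain ⟨g, rfl⟩ := RingQuot.mkAlgHom_surjective K (SocleRel K m q) g
  induction g using PathAlgebra.induction_on with
  | h0 => exact ⟨0, 0, 0, 0, by rw [map_zero, QuantumRel.elem_zero]⟩
  | hadd g h ihg ihh =>
    obtain ⟨a, b, c, d, hg⟩ := ihg
    obtain ⟨a', b', c', d', hh⟩ := ihh
    exact ⟨_, _, _, _, by rw [map_add, hg, hh, QuantumRel.elem_add]⟩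
  | hof k p =>
    obtain ⟨a, b, c, d, h⟩ := socle_exists_elem_ofPath q p.path
    exact ⟨_, _, _, _, by rw [map_smul, h, smul_elem]⟩

/-- The left regular representation of the algebra `Λ_q`. -/
def regularRep (q : ZMod m → Kˣ) :
    SocleDeformation K m q →ₐ[K] Module.End K (SocleCoord K m) :=
  RingQuot.liftAlgHom K ⟨pathLift (regularRel q), fun _ _ h =>
    pathLift_rel (regularRel q) (regularRel_ι_smul q) h⟩

theorem regularRep_mk (q : ZMod m → Kˣ) (g : PathAlgebra K (CyclicVertex m)) :
    regularRep q (RingQuot.mkAlgHom K (SocleRel K m q) g) = pathLift (regularRel q) g :=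
  RingQuot.liftAlgHom_mkAlgHom_apply K _ _ g

theorem regularRep_ι (q : ZMod m → Kˣ) (r : ZMod m → K) :
    regularRep q ((socleQuantumRel q).ι r) = (regularRel q).ι r := by
  refine (regularRep_mk q _).trans ?_
  change pathLift (regularRel q) (vertexSum K r) = _
  rw [vertexSum, map_sum]
  simp only [map_smul, pathLift_nil, ← regularRel_ι_smul]
  rw [← map_sum]
  congr 1
  funext j
  simp [Finset.sum_apply, Pi.single_apply]

theorem regularRep_x (q : ZMod m → Kˣ) :
    regularRep q (socleQuantumRel q).x = (regularRel q).x := by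
  refine (regularRep_mk q _).trans ?_
  rw [sumA, map_sum]
  simp only [pathLift_arrowA]
  rw [← Finset.sum_mul, ← map_sum, sum_single_one, map_one, one_mul]

theorem regularRep_y (q : ZMod m → Kˣ) :
    regularRep q (socleQuantumRel q).y = (regularRel q).y := by
  refine (regularRep_mk q _).trans ?_
  rw [sumAbar, map_sum]
  simp only [pathLift_arrowAbar]
  have h : ∑ i : ZMod m, (regularRel q).ι (Pi.single (i + 1) 1) =
      ∑ i, (regularRel q).ι (Pi.single i 1) :=
    Equiv.sum_comp (Equiv.addRight (1 : ZMod m)) fun i => (regularRel q).ι (Pi.single i 1)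
  rw [← Finset.sum_mul, h, ← map_sum, sum_single_one, map_one, one_mul]

/-- Acting on `1` recovers the coefficients, so that `1, x, y, xy` are independent over
`K ^ (ℤ / m)`. -/
theorem regularRep_elem (q : ZMod m → Kˣ) (a b c d : ZMod m → K) :
    regularRep q ((socleQuantumRel q).elem a b c d) (1, 0, 0, 0) = (a, b, c, d) := by
  simp only [QuantumRel.elem, map_add, map_mul, regularRep_ι, regularRep_x, regularRep_y]
  ext <;> simp [regularRel]

/-- The algebra `Λ_q` is a quantum exterior algebra over `K ^ (ℤ / m)`. -/
def socleQuantumExterior (q : ZMod m → Kˣ) :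
    QuantumExterior (ZMod m → K) (SocleDeformation K m q) (shift K m) (unitsOfFamily q) where
  toQuantumRel := socleQuantumRel q
  coord :=
    { toFun := fun g => regularRep q g (1, 0, 0, 0)
      invFun := fun v => (socleQuantumRel q).elem v.1 v.2.1 v.2.2.1 v.2.2.2
      left_inv := fun g => by
        obtain ⟨a, b, c, d, rfl⟩ := socle_exists_elem q g
        simp only [regularRep_elem]
      right_inv := fun v => regularRep_elem q _ _ _ _ }
  coord_symm _ _ _ _ := rfl

end SocleDeformation

end

theorem mainTheorem4 (K : Type u) [Field K] (m : ℕ) [NeZero m] (q : ZMod m → Kˣ) :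
    Module.Finite (gradedCentre (SocleDeformation K m q)) (ExtAlgebra (SocleDeformation K m q)) ↔
      ∃ d : ℕ, 0 < d ∧ (∏ i : ZMod m, q i) ^ d = 1 := by
  have h := (socleQuantumExterior q).quantumPlane.finite_iff fun i => neg_ne_zero.mpr (q i).ne_zero
  refine Iff.trans h ?_
  have hval : ((∏ i : ZMod m, q i : Kˣ) : K) = ∏ i, (q i : K) := map_prod (Units.coeHom K) _ _
  have hneg : ∏ i : ZMod m, (-(unitsOfFamily q : ZMod m → K)) i =
      (-1) ^ m * ((∏ i : ZMod m, q i : Kˣ) : K) := by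
    rw [hval]
    simp only [Pi.neg_apply, unitsOfFamily_apply]
    rw [Finset.prod_neg, Finset.card_univ, ZMod.card]
  have hsq : (∏ i : ZMod m, (-(unitsOfFamily q : ZMod m → K)) i) ^ 2 =
      (((∏ i : ZMod m, q i : Kˣ) ^ 2 : Kˣ) : K) := by
    rw [hneg, mul_pow, ← pow_mul, mul_comm m 2, pow_mul, neg_one_sq, one_pow, one_mul,
      Units.val_pow_eq_pow_val]
  -- The two products differ by a sign, so their squares agree.
  constructor
  · rintro ⟨d, hd, h⟩
    refine ⟨2 * d, by lia, Units.ext ?_⟩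
    rw [pow_mul, Units.val_pow_eq_pow_val, ← hsq, ← pow_mul, mul_comm, pow_mul, h, one_pow,
      Units.val_one]
  · rintro ⟨d, hd, h⟩
    refine ⟨2 * d, by lia, ?_⟩
    rw [pow_mul, hsq, ← Units.val_pow_eq_pow_val, ← pow_mul, mul_comm, pow_mul, h, one_pow,
      Units.val_one]
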